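/- A rooted tree is a finite, connected, cycle-free graph with a distinguished vertex, its root. Let $\mathbb T$ be the set of isomorphism classes of rooted trees; $V(t)$, $E(t)$ are the sets of vertices and edges of $t$, and $|t|$ is the number of its vertices. For $e\in E(t)$, removing $e$ divides $t$ into two rooted trees: $R_e(t)$, which contains the root of $t$, and $P_e(t)$, the other one, rooted at its endpoint of $e$. For $s,t\in\mathbb T$ and $v\in V(s)$ let $s\cup_v t$ be the rooted tree obtained by joining the root of $t$ to the vertex $v$ of $s$ by one edge, its root being that of $s$. For $t_1,t_2,t_3\in\mathbb T$ put $$\alpha(t_1,t_2,t_3)=|\{e\in E(t_2) : R_e(t_2)=t_3,\ P_e(t_2)=t_1\}|,\qquad \beta(t_1,t_2,t_3)=|\{v\in V(t_3) : t_1=t_3\cup_v t_2\}|.$$ The insertion-elimination algebra $\mathfrak g$ is the complex Lie algebra with basis $\{d\}\cup\{D_t^+,D_t^- : t\in\mathbb T\}$ and brackets, for $s,t\in\mathbb T$, $$[D_s^+,D_t^+]=\sum_{r\in\mathbb T}\bigl(\beta(r,s,t)-\beta(r,t,s)\bigr)D_r^+,\qquad [D_s^-,D_t^-]=\sum_{r\in\mathbb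 T}\bigl(\alpha(t,r,s)-\alpha(s,r,t)\bigr)D_r^-,$$ $$[D_s^-,D_t^+]=\sum_{r\in\mathbb T}\alpha(s,t,r)D_r^++\sum_{r\in\mathbb T}\beta(s,t,r)D_r^-\quad(s\ne t),\qquad [D_t^-,D_t^+]=d,$$ $$[d,D_t^-]=-|t|D_t^-,\qquad [d,D_t^+]=|t|D_t^+.$$ Let $\mathrm{Aut}_{\mathbb C}(\mathfrak g)$ be the group of $\mathbb C$-linear Lie algebra automorphisms of $\mathfrak g$, and for $\zeta\in\mathbb C\setminus\{0\}$ let $\tau_\zeta\in\mathrm{Aut}_{\mathbb C}(\mathfrak g)$ be the automorphism with $\tau_\zeta(d)=d$, $\tau_\zeta(D_t^+)=\zeta^{|t|}D_t^+$ and $\tau_\zeta(D_t^-)=\zeta^{-|t|}D_t^-$ for all $t\in\mathbb T$. Then the center of $\mathrm{Aut}_{\mathbb C}(\mathfrak g)$ is $\{\mathrm{id}_{\mathfrak g},\tau_{-1}\}$, and $\tau_{-1}\neq\mathrm{id}_{\mathfrak g}$, so that the center has exactly two elements. -/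

import Mathlib

namespace InsertionElimination

/-- A finite rooted tree: a rooted tree in the sense of Mathlib (its set of vertices ordered by
ancestorship, `⊥` being the root and `Order.pred x` the parent of `x`) with finitely many
vertices. -/
structure FinTree where
  /-- the underlying rooted tree -/
  tree : RootedTree.{0}
  /-- the set of vertices is finite -/
  finite : Finite tree

instance : CoeSort FinTree Type := ⟨fun t => t.tree.α⟩

instance (t : FinTree) : Finite t := t.finite

noncomputable instance (t : FinTree) : Fintype t := Fintype.ofFinite _

/-- Two finite rooted trees are isomorphic if there is an isomorphism of the ancestorship orders,
i.e. a root-preserving graph isomorphism. -/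
instance isoSetoid : Setoid FinTree where
  r s t := Nonempty (s ≃o t)
  iseqv :=
    { refl := fun s => ⟨OrderIso.refl s⟩
      symm := fun ⟨e⟩ => ⟨e.symm⟩
      trans := fun ⟨e⟩ ⟨f⟩ => ⟨e.trans f⟩ }

/-- The set `𝕋` of isomorphism classes of finite rooted trees. -/
def Tree : Type 1 := Quotient isoSetoid

/-- The isomorphism class of a finite rooted tree. -/
def cl (t : FinTree) : Tree := Quotient.mk isoSetoid t

/-- A representative of an isomorphism class of trees. -/
noncomputable def Tree.rep (t : Tree) : FinTree := Quotient.out t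

/-- `|t|`, the number of vertices. -/
noncomputable def Tree.size (t : Tree) : ℕ := Nat.card t.rep

/-! ### Cutting an edge -/

/-- The edges of `t`: each vertex `e` other than the root stands for the edge which joins `e` to its
parent. -/
abbrev Edge (t : FinTree) : Type := {e : t // e ≠ ⊥}

/-- `P_e(t)`: the part of `t` that does not contain the root when `e` is removed, i.e. the
descendants of `e`, with root `e`. -/
noncomputable def branch (t : FinTree) (e : Edge t) : FinTree where
  tree := { α := Set.Ici e.1 }
  finite := inferInstanceAs (Finite (Set.Ici e.1))

/-- The vertices of `R_e(t)`: those that do not descend from `e`. -/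
def trunkSet (t : FinTree) (e : Edge t) : Set t := {x | ¬ e.1 ≤ x}

instance (t : FinTree) (e : Edge t) : (trunkSet t e).OrdConnected :=
  ⟨fun _ _ _ hy _ hz h => hy (h.trans hz.2)⟩

noncomputable instance (t : FinTree) (e : Edge t) : SemilatticeInf (trunkSet t e) :=
  Subtype.semilatticeInf fun {_ _} hx _ h => hx (h.trans inf_le_left)

instance (t : FinTree) (e : Edge t) : OrderBot (trunkSet t e) :=
  Subtype.orderBot (fun h => e.2 (le_bot_iff.1 h))

/-- `R_e(t)`: the part of `t` that contains the root when `e` is removed. -/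
noncomputable def trunk (t : FinTree) (e : Edge t) : FinTree where
  tree := { α := trunkSet t e }
  finite := inferInstanceAs (Finite (trunkSet t e))

/-! ### Joining two trees -/

/-- The vertices of `s ∪_v t`: those of `s` and those of `t`. -/
inductive Join (s t : FinTree) (v : s) : Type
  | left (x : s) : Join s t v
  | right (y : t) : Join s t v

namespace Join

variable {s t : FinTree} {v : s}

/-- The ancestorship order of `s ∪_v t`, where the root of `t` becomes a child of `v`: the ancestors
of a vertex of `t` are its ancestors in `t` and the ancestors of `v` in `s` (`v` included). -/
protected def le : Join s t v → Join s t v → Prop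
  | left x, left x' => x ≤ x'
  | left x, right _ => x ≤ v
  | right _, left _ => False
  | right y, right y' => y ≤ y'

instance : LE (Join s t v) := ⟨Join.le⟩

@[simp] theorem left_le_left {x x' : s} : (left x : Join s t v) ≤ left x' ↔ x ≤ x' := Iff.rfl
@[simp] theorem left_le_right {x : s} {y : t} : (left x : Join s t v) ≤ right y ↔ x ≤ v := Iff.rfl
@[simp] theorem right_le_left {x : s} {y : t} : ¬ (right y : Join s t v) ≤ left x := id
@[simp] theorem right_le_right {y y' : t} : (right y : Join s t v) ≤ right y' ↔ y ≤ y' := Iff.rfl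

instance : PartialOrder (Join s t v) where
  le_refl a := by cases a <;> simp
  le_trans a b c := by
    cases a <;> cases b <;> cases c <;> simp <;> intro h h' <;> first | exact h.trans h' | exact h
  le_antisymm a b := by
    cases a <;> cases b <;> simp <;> intro h h' <;> exact le_antisymm h h'

/-- The last common ancestor. -/
protected def inf : Join s t v → Join s t v → Join s t v
  | left x, left x' => left (x ⊓ x')
  | left x, right _ => left (x ⊓ v)
  | right _, left x => left (v ⊓ x)
  | right y, right y' => right (y ⊓ y')

instance : SemilatticeInf (Join s t v) where
  inf := Join.inf
  inf_le_left a b := by cases a <;> cases b <;> simp [Join.inf]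
  inf_le_right a b := by cases a <;> cases b <;> simp [Join.inf]
  le_inf a b c := by cases a <;> cases b <;> cases c <;> simp +contextual [Join.inf]

instance : OrderBot (Join s t v) where
  bot := left ⊥
  bot_le a := by cases a <;> simp

theorem bot_eq : (⊥ : Join s t v) = left ⊥ := rfl

open Classical in
/-- The parent of a vertex; the parent of the root of `t` is `v`. -/
protected noncomputable def pred : Join s t v → Join s t v
  | left x => left (Order.pred x)
  | right y => if y = ⊥ then left v else right (Order.pred y)

theorem pred_aux_left (x : s) :
    Join.pred (left x : Join s t v) = left (Order.pred x) := rfl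

theorem pred_aux_bot : Join.pred (right ⊥ : Join s t v) = left v := if_pos rfl

theorem pred_aux_right {y : t} (h : y ≠ ⊥) :
    Join.pred (right y : Join s t v) = right (Order.pred y) := if_neg h

noncomputable instance : PredOrder (Join s t v) where
  pred := Join.pred
  pred_le a := by
    cases a with
    | left x => simp [pred_aux_left, Order.pred_le]
    | right y =>
      by_cases hy : y = ⊥
      · subst hy; simp [pred_aux_bot]
      · simp [pred_aux_right hy, Order.pred_le]
  min_of_le_pred {a} := by
    cases a with
    | left x =>
      simp only [pred_aux_left, left_le_left]
      intro h
      have hx := (Order.le_pred_iff_isMin.1 h).eq_bot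
      subst hx
      exact isMin_bot
    | right y =>
      by_cases hy : y = ⊥
      · subst hy; simp [pred_aux_bot]
      · rw [pred_aux_right hy, right_le_right]
        intro h
        exact absurd (Order.le_pred_iff_isMin.1 h).eq_bot hy
  le_pred_of_lt {a b} h := by
    rw [lt_iff_le_not_ge] at h
    cases b with
    | left x =>
      cases a with
      | left x' =>
        simp only [left_le_left, pred_aux_left] at h ⊢
        exact Order.le_pred_of_lt (lt_iff_le_not_ge.2 h)
      | right y' => simp at h
    | right y =>
      by_cases hy : y = ⊥
      · subst hy
        rw [pred_aux_bot]
        cases a with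
        | left x' => simpa using h
        | right y' => simp at h
      · rw [pred_aux_right hy]
        cases a with
        | left x' => simpa using h
        | right y' =>
          simp only [right_le_right] at h ⊢
          exact Order.le_pred_of_lt (lt_iff_le_not_ge.2 h)

theorem pred_left (x : s) : Order.pred (left x : Join s t v) = left (Order.pred x) := rfl

theorem pred_right_bot : Order.pred (right ⊥ : Join s t v) = left v := if_pos rfl

theorem pred_right {y : t} (h : y ≠ ⊥) :
    Order.pred (right y : Join s t v) = right (Order.pred y) := if_neg h

theorem pred_iterate_left (n : ℕ) (x : s) :
    Order.pred^[n] (left x : Join s t v) = left (Order.pred^[n] x) := by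
  induction n generalizing x with
  | zero => rfl
  | succ n ih => simp [pred_left, ih]

theorem exists_pred_iterate_right (y' y : t) (h : y' ≤ y) :
    ∃ n, Order.pred^[n] (right y : Join s t v) = right y' := by
  obtain ⟨n, hn⟩ := h.exists_pred_iterate
  induction n generalizing y with
  | zero => exact ⟨0, by simpa using hn⟩
  | succ n ih =>
    by_cases hy : y = ⊥
    · subst hy
      exact ⟨0, by simp [le_bot_iff.1 h]⟩
    · rw [Function.iterate_succ_apply] at hn
      have h' : y' ≤ Order.pred y := by rw [← hn]; exact Order.pred_iterate_le _ _
      obtain ⟨m, hm⟩ := ih _ h' hn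
      exact ⟨m + 1, by rw [Function.iterate_succ_apply, pred_right hy, hm]⟩

instance : IsPredArchimedean (Join s t v) where
  exists_pred_iterate_of_le {a b} h := by
    cases b with
    | left x =>
      cases a with
      | left x' =>
        obtain ⟨n, hn⟩ := (left_le_left.1 h).exists_pred_iterate
        exact ⟨n, by rw [pred_iterate_left, hn]⟩
      | right y' => exact absurd h right_le_left
    | right y =>
      cases a with
      | left x' =>
        obtain ⟨m, hm⟩ := exists_pred_iterate_right (v := v) ⊥ y bot_le
        obtain ⟨n, hn⟩ := (left_le_right.1 h).exists_pred_iterate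
        exact ⟨n + (1 + m), by
          rw [Function.iterate_add_apply, Function.iterate_add_apply, hm, Function.iterate_one,
            pred_right_bot, pred_iterate_left, hn]⟩
      | right y' => exact exists_pred_iterate_right y' y (right_le_right.1 h)

/-- The vertices of `s ∪_v t` as a disjoint sum. -/
def equivSum : s ⊕ t ≃ Join s t v where
  toFun := Sum.elim left right
  invFun
    | left x => .inl x
    | right y => .inr y
  left_inv a := by cases a <;> rfl
  right_inv a := by cases a <;> rfl

instance : Finite (Join s t v) := Finite.of_equiv _ equivSum

end Join

/-- The tree `s ∪_v t`, obtained by joining the root of `t` to the vertex `v` of `s` by an edge; its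
root is that of `s`. -/
noncomputable def join (s : FinTree) (v : s) (t : FinTree) : FinTree where
  tree := { α := Join s t v }
  finite := inferInstanceAs (Finite (Join s t v))

/-! ### The statistics and the Lie algebra -/

/-- `α(t₁, t₂, t₃)`: the number of edges `e` of `t₂` with `R_e(t₂) = t₃` and `P_e(t₂) = t₁`, counted
in a representative of `t₂` (the choice is irrelevant, see `alpha_cl`). -/
noncomputable def alpha (t₁ t₂ t₃ : Tree) : ℕ :=
  Nat.card {e : Edge t₂.rep // cl (trunk t₂.rep e) = t₃ ∧ cl (branch t₂.rep e) = t₁}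

/-- `β(t₁, t₂, t₃)`: the number of vertices `v` of `t₃` with `t₁ = t₃ ∪_v t₂`, counted in a
representative of `t₃` (the choice is irrelevant, see `beta_cl`). -/
noncomputable def beta (t₁ t₂ t₃ : Tree) : ℕ :=
  Nat.card {v : t₃.rep // t₁ = cl (join t₃.rep v t₂.rep)}

/-- The index set of the basis `{d} ∪ {D_t^+, D_t^- | t ∈ 𝕋}`. -/
inductive Index : Type 1
  | d : Index
  | plus (t : Tree) : Index
  | minus (t : Tree) : Index

/-- The underlying vector space of the insertion-elimination algebra: the complex vector space with
basis `{d} ∪ {D_t^+, D_t^- | t ∈ 𝕋}`. -/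
def InsElim : Type 1 := Index →₀ ℂ

noncomputable instance : AddCommGroup InsElim := inferInstanceAs (AddCommGroup (Index →₀ ℂ))
noncomputable instance : Module ℂ InsElim := inferInstanceAs (Module ℂ (Index →₀ ℂ))

/-- The standard basis. -/
noncomputable def stdBasis : Module.Basis Index ℂ InsElim := ⟨LinearEquiv.refl ℂ (Index →₀ ℂ)⟩

/-- The basis vector `d`. -/
noncomputable def d : InsElim := stdBasis .d
/-- The basis vector `D_t^+`. -/
noncomputable def Dplus (t : Tree) : InsElim := stdBasis (.plus t)
/-- The basis vector `D_t^-`. -/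
noncomputable def Dminus (t : Tree) : InsElim := stdBasis (.minus t)

open Classical in
/-- The defining relations: the bracket of two basis vectors. All the sums over `𝕋` have finitely
many nonzero terms (see `finite_alpha_right`, `finite_alpha_mid`, `finite_beta_left`,
`finite_beta_right`). -/
noncomputable def basisBracket : Index → Index → InsElim
  | .d, .d => 0
  | .d, .plus t => (t.size : ℂ) • Dplus t
  | .plus t, .d => -((t.size : ℂ) • Dplus t)
  | .d, .minus t => -((t.size : ℂ) • Dminus t)
  | .minus t, .d => (t.size : ℂ) • Dminus t
  | .plus s, .plus t => ∑ᶠ r : Tree, ((beta r s t : ℂ) - (beta r t s : ℂ)) • Dplus r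
  | .minus s, .minus t => ∑ᶠ r : Tree, ((alpha t r s : ℂ) - (alpha s r t : ℂ)) • Dminus r
  | .minus s, .plus t =>
      if s = t then d
      else (∑ᶠ r : Tree, (alpha s t r : ℂ) • Dplus r) + ∑ᶠ r : Tree, (beta s t r : ℂ) • Dminus r
  | .plus t, .minus s =>
      -(if s = t then d
        else (∑ᶠ r : Tree, (alpha s t r : ℂ) • Dplus r) + ∑ᶠ r : Tree, (beta s t r : ℂ) • Dminus r)

/-- The bracket: the bilinear extension of the bracket of basis vectors. -/
noncomputable def bracket : InsElim →ₗ[ℂ] InsElim →ₗ[ℂ] InsElim :=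
  stdBasis.constr ℂ fun i => stdBasis.constr ℂ fun j => basisBracket i j

/-! ### The Jacobi identity, through the natural action on the span of rooted trees -/

/-- The one-vertex tree. -/
def onePoint : FinTree where
  tree :=
    letI : PredOrder PUnit.{1} :=
      { pred := id, pred_le := fun _ => le_rfl, min_of_le_pred := fun _ _ _ => le_rfl,
        le_pred_of_lt := fun _ => le_rfl }
    letI : IsPredArchimedean PUnit.{1} := ⟨fun _ => ⟨0, rfl⟩⟩
    { α := PUnit.{1} }
  finite := inferInstanceAs (Finite PUnit.{1})

theorem cl_eq_cl {s t : FinTree} : cl s = cl t ↔ Nonempty (s ≃o t) := Quotient.eq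

theorem cl_rep (t : Tree) : cl t.rep = t := Quotient.out_eq t

theorem exists_cl (t : Tree) : ∃ u, cl u = t := ⟨_, cl_rep t⟩

open Classical in
/-- The isomorphism class of an ordered set which happens to be a finite rooted tree. -/
noncomputable def shape (X : Type) [LE X] : Tree :=
  if h : ∃ u : FinTree, Nonempty (u ≃o X) then cl h.choose else cl onePoint

theorem shape_eq {X : Type} [LE X] (u : FinTree) (e : u ≃o X) : shape X = cl u := by
  have h : ∃ u : FinTree, Nonempty (u ≃o X) := ⟨u, ⟨e⟩⟩
  rw [shape, dif_pos h, cl_eq_cl]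
  exact ⟨h.choose_spec.some.trans e.symm⟩

theorem shape_congr {X Y : Type} [LE X] [LE Y] (e : X ≃o Y) : shape X = shape Y := by
  by_cases h : ∃ u : FinTree, Nonempty (u ≃o X)
  · obtain ⟨u, ⟨f⟩⟩ := h
    rw [shape_eq u f, shape_eq u (f.trans e)]
  · have h' : ¬ ∃ u : FinTree, Nonempty (u ≃o Y) :=
      fun ⟨u, ⟨f⟩⟩ => h ⟨u, ⟨f.trans e.symm⟩⟩
    rw [shape, shape, dif_neg h, dif_neg h']

/-- An order isomorphism between two subtypes. -/
theorem shape_subtype {X Y : Type} [LE X] [LE Y] {p : X → Prop} {q : Y → Prop}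
    (f : X → Y) (hf : ∀ x x', p x → p x' → (f x ≤ f x' ↔ x ≤ x')) (hi : ∀ x x', f x = f x' → x = x')
    (hp : ∀ x, p x → q (f x)) (hq : ∀ y, q y → ∃ x, p x ∧ f x = y) :
    shape {x // p x} = shape {y // q y} := by
  refine shape_congr ⟨Equiv.ofBijective (fun x => ⟨f x.1, hp _ x.2⟩) ⟨?_, ?_⟩, ?_⟩
  · intro a b h
    exact Subtype.ext (hi _ _ (congrArg Subtype.val h))
  · rintro ⟨y, hy⟩
    obtain ⟨x, hx, rfl⟩ := hq y hy
    exact ⟨⟨x, hx⟩, rfl⟩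
  · intro a b
    exact hf _ _ a.2 b.2

/-- The class of the descendants of `x`. -/
noncomputable def br (u : FinTree) (x : u) : Tree := shape {y : u // x ≤ y}

/-- The class of the non-descendants of `x`. -/
noncomputable def tr (u : FinTree) (x : u) : Tree := shape {y : u // ¬ x ≤ y}

/-- The tree of descendants of `x`. -/
noncomputable def sub (u : FinTree) (x : u) : FinTree where
  tree := { α := Set.Ici x }
  finite := inferInstanceAs (Finite (Set.Ici x))

theorem cl_sub (u : FinTree) (x : u) : cl (sub u x) = br u x :=
  (shape_eq (sub u x) (OrderIso.refl _)).symm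

theorem cl_branch (u : FinTree) (x : Edge u) : cl (branch u x) = br u x.1 :=
  (shape_eq (branch u x) (OrderIso.refl _)).symm

theorem cl_trunk (u : FinTree) (x : Edge u) : cl (trunk u x) = tr u x.1 :=
  (shape_eq (trunk u x) (OrderIso.refl _)).symm

/-- The bijection between joins which is induced by isomorphisms. -/
def joinEquiv {s s' t t' : FinTree} (e : s ≃o s') (f : t ≃o t') (v : s) :
    Join s t v ≃ Join s' t' (e v) where
  toFun
    | .left x => .left (e x)
    | .right y => .right (f y)
  invFun
    | .left x => .left (e.symm x)
    | .right y => .right (f.symm y)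
  left_inv a := by cases a <;> simp
  right_inv a := by cases a <;> simp

/-- Joining respects isomorphisms. -/
def joinCongr {s s' t t' : FinTree} (e : s ≃o s') (f : t ≃o t') (v : s) :
    join s v t ≃o join s' (e v) t' :=
  show Join s t v ≃o Join s' t' (e v) from
  { joinEquiv e f v with
    map_rel_iff' := fun {a b} => by
      cases a <;> cases b <;> simp [joinEquiv] }

theorem alpha_cl (s r : Tree) (u : FinTree) :
    alpha s (cl u) r = Nat.card {x : u // tr u x = r ∧ x ≠ ⊥ ∧ br u x = s} := by
  obtain ⟨e⟩ := cl_eq_cl.1 (cl_rep (cl u))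
  have h1 : ∀ x, br (cl u).rep x = br u (e x) := fun x =>
    shape_subtype e (by simp) (by simp) (by simp)
      (fun y hy => ⟨e.symm y, by simpa [OrderIso.le_symm_apply] using hy, by simp⟩)
  have h2 : ∀ x, tr (cl u).rep x = tr u (e x) := fun x =>
    shape_subtype e (by simp) (by simp) (by simp)
      (fun y hy => ⟨e.symm y, by simpa [OrderIso.le_symm_apply] using hy, by simp⟩)
  unfold alpha
  simp only [cl_trunk, cl_branch, h1, h2]
  refine Nat.card_congr
    { toFun := fun x => ⟨e x.1.1, x.2.1, by simpa using x.1.2, x.2.2⟩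
      invFun := fun x => ⟨⟨e.symm x.1, by simpa using x.2.2.1⟩, by simpa using x.2.1,
        by simpa using x.2.2.2⟩
      left_inv := fun x => by simp
      right_inv := fun x => by simp }

theorem beta_cl (r : Tree) (t u : FinTree) :
    beta r (cl t) (cl u) = Nat.card {v : u // cl (join u v t) = r} := by
  obtain ⟨e⟩ := cl_eq_cl.1 (cl_rep (cl u))
  obtain ⟨f⟩ := cl_eq_cl.1 (cl_rep (cl t))
  unfold beta
  refine Nat.card_congr (e.toEquiv.subtypeEquiv fun v => ?_)
  rw [show cl (join (cl u).rep v (cl t).rep) = cl (join u (e v) t) from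
    cl_eq_cl.2 ⟨joinCongr e f v⟩]
  exact eq_comm

/-! #### Sizes and finiteness -/

theorem size_cl (u : FinTree) : (cl u).size = Nat.card u := by
  obtain ⟨e⟩ := cl_eq_cl.1 (cl_rep (cl u))
  exact Nat.card_congr e.toEquiv

theorem card_pos (u : FinTree) : 0 < Nat.card u := Nat.card_pos_iff.2 ⟨⟨⊥⟩, inferInstance⟩

theorem card_join (u t : FinTree) (v : u) : Nat.card (join u v t) = Nat.card u + Nat.card t := by
  rw [← Nat.card_sum]
  exact Nat.card_congr Join.equivSum.symm

theorem size_br_add_size_tr (u : FinTree) {x : u} (h : x ≠ ⊥) :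
    (br u x).size + (tr u x).size = (cl u).size := by
  classical
  rw [← cl_branch u ⟨x, h⟩, ← cl_trunk u ⟨x, h⟩, size_cl, size_cl, size_cl, ← Nat.card_sum]
  exact Nat.card_congr (Equiv.sumCompl fun y => x ≤ y)

theorem alpha_ne_zero {s t r : Tree} (h : alpha s t r ≠ 0) : t.size = s.size + r.size := by
  obtain ⟨u, rfl⟩ := exists_cl t
  rw [alpha_cl] at h
  obtain ⟨⟨x, rfl, hx, rfl⟩⟩ := (Nat.card_ne_zero.1 h).1
  exact (size_br_add_size_tr u hx).symm

theorem beta_ne_zero {r s t : Tree} (h : beta r s t ≠ 0) : r.size = s.size + t.size := by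
  obtain ⟨u, rfl⟩ := exists_cl t
  obtain ⟨w, rfl⟩ := exists_cl s
  rw [beta_cl] at h
  obtain ⟨⟨v, rfl⟩⟩ := (Nat.card_ne_zero.1 h).1
  rw [size_cl, size_cl, size_cl, card_join, add_comm]

theorem finite_size (n : ℕ) : {r : Tree | r.size = n}.Finite := by
  let e : ∀ r : {r : Tree | r.size = n}, r.1.rep ≃ Fin n := fun r =>
    Finite.equivFinOfCardEq r.2
  have inj : Function.Injective
      (fun (r : {r : Tree | r.size = n}) (i j : Fin n) => (e r).symm i ≤ (e r).symm j) := by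
    intro r s h
    refine Subtype.ext ?_
    rw [← cl_rep r.1, ← cl_rep s.1, cl_eq_cl]
    refine ⟨⟨(e r).trans (e s).symm, ?_⟩⟩
    intro a b
    have := congrFun (congrFun h (e r a)) (e r b)
    simpa using this.symm.to_iff
  have : Finite {r : Tree | r.size = n} := Finite.of_injective _ inj
  exact Set.toFinite _

theorem finite_alpha_right (s t : Tree) : (Function.support (alpha s t)).Finite :=
  (Set.finite_iUnion fun n : Fin (t.size + 1) => finite_size n).subset fun r hr => by
    have := alpha_ne_zero hr
    exact Set.mem_iUnion.2 ⟨⟨r.size, by omega⟩, rfl⟩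

theorem finite_alpha_mid (s r : Tree) : (Function.support fun t => alpha s t r).Finite :=
  (finite_size (s.size + r.size)).subset fun _ ht => alpha_ne_zero ht

theorem finite_beta_left (s t : Tree) : (Function.support fun r => beta r s t).Finite :=
  (finite_size (s.size + t.size)).subset fun _ hr => beta_ne_zero hr

theorem finite_beta_right (r s : Tree) : (Function.support (beta r s)).Finite :=
  (Set.finite_iUnion fun n : Fin (r.size + 1) => finite_size n).subset fun t ht => by
    have := beta_ne_zero ht
    exact Set.mem_iUnion.2 ⟨⟨t.size, by omega⟩, rfl⟩

/-! #### Sums weighted by natural numbers -/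

section Sums

variable {E F : Type*} [AddCommGroup E] [Module ℂ E] [AddCommGroup F] [Module ℂ F]

theorem wsum_eq {a : Tree → ℕ} (ha : (Function.support a).Finite) (f : Tree → E) :
    ∑ᶠ r, (a r : ℂ) • f r = ∑ r ∈ ha.toFinset, (a r : ℂ) • f r := by
  refine finsum_eq_sum_of_support_subset _ fun r hr => ?_
  simp only [Set.Finite.coe_toFinset, Function.mem_support] at hr ⊢
  intro h
  simp [h] at hr

theorem map_wsum {a : Tree → ℕ} (ha : (Function.support a).Finite) (f : Tree → E) (φ : E →ₗ[ℂ] F) :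
    φ (∑ᶠ r, (a r : ℂ) • f r) = ∑ᶠ r, (a r : ℂ) • φ (f r) := by
  rw [wsum_eq ha, wsum_eq ha, map_sum]
  simp

theorem wsum_sub {a b : Tree → ℕ} (ha : (Function.support a).Finite)
    (hb : (Function.support b).Finite) (f : Tree → E) :
    ∑ᶠ r, ((a r : ℂ) - (b r : ℂ)) • f r = ∑ᶠ r, (a r : ℂ) • f r - ∑ᶠ r, (b r : ℂ) • f r := by
  have h : ∀ c : Tree → ℕ, (Function.support c).Finite →
      (Function.support fun r => (c r : ℂ) • f r).Finite := fun c hc => hc.subset fun r hr hc => by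
    simp [hc] at hr
  rw [← finsum_sub_distrib (h a ha) (h b hb)]
  simp [sub_smul]

theorem wsum_card {ι : Type} [Fintype ι] (g : ι → Tree) (p : ι → Prop) [DecidablePred p]
    (f : Tree → E) :
    ∑ᶠ r, (Nat.card {i // g i = r ∧ p i} : ℂ) • f r = ∑ i, if p i then f (g i) else 0 := by
  classical
  rw [finsum_eq_sum_of_support_subset (s := Finset.univ.image g)]
  · have : ∀ r, (Nat.card {i // g i = r ∧ p i} : ℂ) • f r
        = ∑ i, if g i = r then (if p i then f r else 0) else 0 := by
      intro r
      rw [Nat.card_eq_fintype_card, Fintype.card_subtype, Finset.card_eq_sum_ones, Nat.cast_sum,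
        Finset.sum_smul, Finset.sum_filter]
      refine Finset.sum_congr rfl fun i _ => ?_
      by_cases h1 : g i = r <;> by_cases h2 : p i <;> simp [h1, h2]
    simp only [this]
    rw [Finset.sum_comm]
    refine Finset.sum_congr rfl fun i _ => ?_
    rw [Finset.sum_ite_eq, if_pos (Finset.mem_image_of_mem g (Finset.mem_univ i))]
  · intro r hr
    by_contra h
    refine hr ?_
    have : IsEmpty {i // g i = r ∧ p i} := ⟨fun i => h (by
      rw [← i.2.1]; simp)⟩
    simp

theorem wsum_ite {ι : Type} [Fintype ι] [DecidableEq Tree] {a : Tree → ℕ} (ha : (Function.support a).Finite)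
    (g : ι → Tree) (p : ι → Prop) [DecidablePred p] (y : ι → E) :
    ∑ᶠ r, (a r : ℂ) • (∑ i, if p i ∧ g i = r then y i else 0)
      = ∑ i, if p i then (a (g i) : ℂ) • y i else 0 := by
  rw [wsum_eq ha]
  simp only [Finset.smul_sum]
  rw [Finset.sum_comm]
  refine Finset.sum_congr rfl fun i _ => ?_
  by_cases hp : p i
  · simp only [hp, true_and, if_true, smul_ite, smul_zero, Finset.sum_ite_eq]
    split_ifs with h
    · rfl
    · have : a (g i) = 0 := by simpa using h
      simp [this]
  · simp [hp]

theorem card_smul {X : Type} [Fintype X] (p : X → Prop) [DecidablePred p] (y : E) :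
    (Nat.card {x // p x} : ℂ) • y = ∑ x, if p x then y else 0 := by
  rw [Nat.card_eq_fintype_card, Fintype.card_subtype, Finset.card_eq_sum_ones, Nat.cast_sum,
    Finset.sum_smul, Finset.sum_filter]
  refine Finset.sum_congr rfl fun i _ => ?_
  split_ifs <;> simp


end Sums

theorem sum_subtype_ite {E : Type*} [AddCommMonoid E] {X : Type} [Fintype X] (p : X → Prop)
    [DecidablePred p] (inst : Fintype {x // p x}) (f : X → E) :
    ∑ x : {x // p x}, f x.1 = ∑ x, if p x then f x else 0 := by
  rw [← Finset.sum_filter]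
  exact (Finset.sum_subtype _ (by simp) f).symm

/-- The inclusion of `u` into `u ∪_v t`. -/
def inl (u : FinTree) (v : u) (t : FinTree) (x : u) : join u v t := Join.left x

/-- The inclusion of `t` into `u ∪_v t`. -/
def inr (u : FinTree) (v : u) (t : FinTree) (y : t) : join u v t := Join.right y

theorem sum_join {E : Type*} [AddCommMonoid E] (u t : FinTree) (v : u) (f : join u v t → E) :
    ∑ x, f x = ∑ x : u, f (inl u v t x) + ∑ y : t, f (inr u v t y) := by
  rw [← Fintype.sum_sumElim]
  refine (Fintype.sum_equiv (show u ⊕ t ≃ join u v t from Join.equivSum) _ f fun a => ?_).symm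
  cases a <;> rfl

/-! #### The action -/

/-- The span of rooted trees. -/
def TreeSpace : Type 1 := Tree →₀ ℂ

noncomputable instance : AddCommGroup TreeSpace := inferInstanceAs (AddCommGroup (Tree →₀ ℂ))
noncomputable instance : Module ℂ TreeSpace := inferInstanceAs (Module ℂ (Tree →₀ ℂ))

/-- The basis of rooted trees. -/
noncomputable def δ : Module.Basis Tree ℂ TreeSpace := ⟨LinearEquiv.refl ℂ (Tree →₀ ℂ)⟩

/-- Insertion: `u ↦ ∑_v u ∪_v t`. -/
noncomputable def up (t : Tree) : TreeSpace →ₗ[ℂ] TreeSpace :=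
  δ.constr ℂ fun u => ∑ᶠ r, (beta r t u : ℂ) • δ r

/-- Elimination: `u ↦ ∑_{P_e(u) = s} R_e(u)`. -/
noncomputable def dn (s : Tree) : TreeSpace →ₗ[ℂ] TreeSpace :=
  δ.constr ℂ fun u => ∑ᶠ r, (alpha s u r : ℂ) • δ r

/-- The grading operator. -/
noncomputable def gr : TreeSpace →ₗ[ℂ] TreeSpace :=
  δ.constr ℂ fun u => (u.size : ℂ) • δ u

theorem lc_δ (f : Tree → TreeSpace) (u : Tree) : δ.constr ℂ f (δ u) = f u := δ.constr_basis ℂ f u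

theorem gr_δ (u : Tree) : gr (δ u) = (u.size : ℂ) • δ u := lc_δ _ _

theorem wsum_beta {E : Type*} [AddCommGroup E] [Module ℂ E] (t u : FinTree) (f : Tree → E) :
    ∑ᶠ r, (beta r (cl t) (cl u) : ℂ) • f r = ∑ v : u, f (cl (join u v t)) := by
  simpa [beta_cl] using wsum_card (fun v : u => cl (join u v t)) (fun _ => True) f

open Classical in
theorem wsum_alpha {E : Type*} [AddCommGroup E] [Module ℂ E] (s : Tree) (u : FinTree)
    (f : Tree → E) :
    ∑ᶠ r, (alpha s (cl u) r : ℂ) • f r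
      = ∑ x : u, if x ≠ ⊥ ∧ br u x = s then f (tr u x) else 0 := by
  simp only [alpha_cl]
  convert wsum_card (fun x : u => tr u x) (fun x => x ≠ ⊥ ∧ br u x = s) f

theorem up_δ (t u : FinTree) : up (cl t) (δ (cl u)) = ∑ v : u, δ (cl (join u v t)) := by
  rw [up, lc_δ, wsum_beta]

open Classical in
theorem dn_δ (s : Tree) (u : FinTree) :
    dn s (δ (cl u)) = ∑ x : u, if x ≠ ⊥ ∧ br u x = s then δ (tr u x) else 0 := by
  rw [dn, lc_δ, wsum_alpha]

theorem ext_δ {φ ψ : TreeSpace →ₗ[ℂ] TreeSpace} (h : ∀ u, φ (δ (cl u)) = ψ (δ (cl u))) : φ = ψ := by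
  refine δ.ext fun t => ?_
  obtain ⟨u, rfl⟩ := exists_cl t
  exact h u

/-! #### Commutators -/

theorem cl_join_join_right (u t s : FinTree) (v : u) (w : t) :
    cl (join (join u v t) (inr u v t w) s) = cl (join u v (join t w s)) := by
  rw [cl_eq_cl]
  refine ⟨show Join (join u v t) s (inr u v t w) ≃o Join u (join t w s) v from
    { toFun := fun
        | .left (.left x) => .left x
        | .left (.right y) => .right (.left y)
        | .right z => .right (.right z)
      invFun := fun
        | .left x => .left (.left x)
        | .right (.left y) => .left (.right y)
        | .right (.right z) => .right z
      left_inv := fun a => by rcases a with (a | a) | a <;> rfl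
      right_inv := fun a => by rcases a with a | (a | a) <;> rfl
      map_rel_iff' := fun {a b} => by
        rcases a with (a | a) | a <;> rcases b with (b | b) | b <;> exact Iff.rfl }⟩

theorem cl_join_join_left (u t s : FinTree) (v w : u) :
    cl (join (join u v t) (inl u v t w) s) = cl (join (join u w s) (inl u w s v) t) := by
  rw [cl_eq_cl]
  refine ⟨show Join (join u v t) s (inl u v t w) ≃o Join (join u w s) t (inl u w s v) from
    { toFun := fun
        | .left (.left x) => .left (.left x)
        | .left (.right y) => .right y
        | .right z => .left (.right z)
      invFun := fun
        | .left (.left x) => .left (.left x)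
        | .right y => .left (.right y)
        | .left (.right z) => .right z
      left_inv := fun a => by rcases a with (a | a) | a <;> rfl
      right_inv := fun a => by rcases a with (a | a) | a <;> rfl
      map_rel_iff' := fun {a b} => by
        rcases a with (a | a) | a <;> rcases b with (b | b) | b <;> exact Iff.rfl }⟩

theorem up_up (s t u : FinTree) :
    up (cl s) (up (cl t) (δ (cl u))) =
      ∑ v : u, ∑ w : u, δ (cl (join (join u v t) (inl u v t w) s)) +
        (∑ᶠ r, (beta r (cl s) (cl t) : ℂ) • up r) (δ (cl u)) := by
  rw [wsum_beta s t up, LinearMap.sum_apply, up_δ, map_sum]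
  simp only [up_δ]
  rw [Finset.sum_comm (γ := t), ← Finset.sum_add_distrib]
  refine Finset.sum_congr rfl fun v _ => ?_
  rw [sum_join]
  simp only [cl_join_join_right]

theorem comm_up_up (s t : Tree) :
    up s * up t - up t * up s = ∑ᶠ r, ((beta r s t : ℂ) - (beta r t s : ℂ)) • up r := by
  refine ext_δ fun u => ?_
  obtain ⟨s, rfl⟩ := exists_cl s
  obtain ⟨t, rfl⟩ := exists_cl t
  rw [wsum_sub (finite_beta_left _ _) (finite_beta_left _ _) up]
  simp only [LinearMap.sub_apply, Module.End.mul_apply, up_up]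
  rw [Finset.sum_comm]
  simp only [cl_join_join_left u s t]
  abel

/-- The vertices which descend from `f` but not from `e`. -/
noncomputable def mid (u : FinTree) (f e : u) : Tree := shape {y : u // f ≤ y ∧ ¬ e ≤ y}

/-- The vertices which descend neither from `f` nor from `e`. -/
noncomputable def rest (u : FinTree) (f e : u) : Tree := shape {y : u // ¬ f ≤ y ∧ ¬ e ≤ y}

theorem rest_comm (u : FinTree) (f e : u) : rest u f e = rest u e f :=
  shape_subtype id (by simp) (by simp) (fun _ h => h.symm) (fun y h => ⟨y, h.symm, rfl⟩)

theorem rest_of_le (u : FinTree) {f e : u} (h : f ≤ e) : rest u f e = tr u f :=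
  shape_subtype id (by simp) (by simp) (fun _ h => h.1)
    (fun y hy => ⟨y, ⟨hy, fun h' => hy (h.trans h')⟩, rfl⟩)

theorem mid_of_not_le (u : FinTree) {f e : u} (h : ¬ f ≤ e) (h' : ¬ e ≤ f) : mid u f e = br u f :=
  shape_subtype id (by simp) (by simp) (fun _ h => h.1)
    (fun y hy => ⟨y, ⟨hy, fun hy' => ((le_total_of_directed hy hy').elim (fun k => (h' k).elim) (fun k => (h k).elim))⟩, rfl⟩)

open Classical in
theorem dn_tr (s : Tree) (u : FinTree) {e : u} (he : e ≠ ⊥) :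
    dn s (δ (tr u e)) =
      ∑ f : u, if f ≠ ⊥ ∧ ¬ e ≤ f ∧ mid u f e = s then δ (rest u f e) else 0 := by
  rw [← cl_trunk u ⟨e, he⟩, dn_δ]
  have h1 : ∀ x : trunkSet u ⟨e, he⟩, br (trunk u ⟨e, he⟩) x = mid u x.1 e := fun x =>
    shape_subtype (fun y : trunkSet u ⟨e, he⟩ => y.1) (fun _ _ _ _ => Iff.rfl)
      (fun _ _ h => Subtype.ext h) (fun y hy => ⟨hy, y.2⟩) (fun y hy => ⟨⟨y, hy.2⟩, hy.1, rfl⟩)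
  have h2 : ∀ x : trunkSet u ⟨e, he⟩, tr (trunk u ⟨e, he⟩) x = rest u x.1 e := fun x =>
    shape_subtype (fun y : trunkSet u ⟨e, he⟩ => y.1) (fun _ _ _ _ => Iff.rfl)
      (fun _ _ h => Subtype.ext h) (fun y hy => ⟨hy, y.2⟩) (fun y hy => ⟨⟨y, hy.2⟩, hy.1, rfl⟩)
  have h3 : ∀ x : trunkSet u ⟨e, he⟩, (x ≠ (⊥ : trunk u ⟨e, he⟩)) ↔ x.1 ≠ (⊥ : u) := fun x =>
    not_congr Subtype.ext_iff
  have key := sum_subtype_ite (X := u) (fun x => ¬ e ≤ x)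
    (Fintype.ofFinite (trunk u ⟨e, he⟩))
    (fun f => if f ≠ ⊥ ∧ mid u f e = s then δ (rest u f e) else 0)
  refine Eq.trans ?_ (key.trans ?_)
  · refine Fintype.sum_equiv (Equiv.refl _) _ _ fun x => ?_
    rw [h1 x, h2 x]
    exact if_congr (and_congr (h3 x) Iff.rfl) rfl rfl
  · refine Finset.sum_congr rfl fun f _ => ?_
    by_cases h1 : f = ⊥ <;> by_cases h2 : e ≤ f <;> by_cases h3 : mid u f e = s <;>
      simp [h1, h2, h3]

theorem alpha_br (t s : Tree) (u : FinTree) (f : u) :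
    alpha t (br u f) s = Nat.card {e : u // f < e ∧ mid u f e = s ∧ br u e = t} := by
  rw [← cl_sub, alpha_cl]
  have h1 : ∀ x : Set.Ici f, br (sub u f) x = br u x.1 := fun x =>
    shape_subtype (fun y : Set.Ici f => y.1) (fun _ _ _ _ => Iff.rfl)
      (fun _ _ h => Subtype.ext h) (fun y hy => hy) (fun y hy => ⟨⟨y, x.2.trans hy⟩, hy, rfl⟩)
  have h2 : ∀ x : Set.Ici f, tr (sub u f) x = mid u f x.1 := fun x =>
    shape_subtype (fun y : Set.Ici f => y.1) (fun _ _ _ _ => Iff.rfl)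
      (fun _ _ h => Subtype.ext h) (fun y hy => ⟨y.2, hy⟩) (fun y hy => ⟨⟨y, hy.1⟩, hy.2, rfl⟩)
  have h3 : ∀ x : Set.Ici f, (x ≠ (⊥ : sub u f)) ↔ x.1 ≠ f := fun x =>
    not_congr Subtype.ext_iff
  refine Nat.card_congr
    { toFun := fun x => ⟨x.1.1, lt_of_le_of_ne x.1.2 ((h3 x.1).1 x.2.2.1).symm,
        (h2 x.1).symm.trans x.2.1, (h1 x.1).symm.trans x.2.2.2⟩
      invFun := fun x => ⟨⟨x.1, x.2.1.le⟩, (h2 ⟨x.1, x.2.1.le⟩).trans x.2.2.1,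
        (h3 ⟨x.1, x.2.1.le⟩).2 x.2.1.ne', (h1 ⟨x.1, x.2.1.le⟩).trans x.2.2.2⟩
      left_inv := fun x => rfl
      right_inv := fun x => rfl }

open Classical in
theorem wsum_dn {a : Tree → ℕ} (ha : (Function.support a).Finite) (u : FinTree) :
    (∑ᶠ r, (a r : ℂ) • dn r) (δ (cl u))
      = ∑ f : u, if f ≠ ⊥ then (a (br u f) : ℂ) • δ (tr u f) else 0 := by
  have := map_wsum ha dn (LinearMap.applyₗ (δ (cl u)))
  simp only [LinearMap.applyₗ_apply_apply] at this
  rw [this]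
  simp only [dn_δ]
  convert wsum_ite ha (fun x => br u x) (fun x => x ≠ ⊥) (fun x => δ (tr u x))

open Classical in
theorem dn_dn (s t : Tree) (u : FinTree) :
    dn s (dn t (δ (cl u))) =
      (∑ e : u, ∑ f : u, if (e ≠ ⊥ ∧ f ≠ ⊥) ∧ (¬ e ≤ f ∧ ¬ f ≤ e) ∧ br u e = t ∧ br u f = s
        then δ (rest u f e) else 0) +
      (∑ᶠ r, (alpha t r s : ℂ) • dn r) (δ (cl u)) := by
  rw [wsum_dn (finite_alpha_mid _ _), dn_δ, map_sum]
  simp only [alpha_br, card_smul]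
  have h1 : ∀ e : u, dn s (if e ≠ ⊥ ∧ br u e = t then δ (tr u e) else 0) =
      ∑ f : u, if (e ≠ ⊥ ∧ br u e = t) ∧ (f ≠ ⊥ ∧ ¬ e ≤ f ∧ mid u f e = s) then δ (rest u f e)
        else 0 := by
    intro e
    by_cases h : e ≠ ⊥ ∧ br u e = t
    · rw [if_pos h, dn_tr s u h.1]
      simp only [h, true_and, ne_eq, not_false_eq_true]
    · simp [h]
  have h2 : ∀ f : u, (if f ≠ ⊥ then
      (∑ e : u, if f < e ∧ mid u f e = s ∧ br u e = t then δ (tr u f) else 0) else 0) =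
      ∑ e : u, if f ≠ ⊥ ∧ f < e ∧ mid u f e = s ∧ br u e = t then δ (tr u f) else 0 := by
    intro f
    by_cases h : f ≠ ⊥
    · rw [if_pos h]
      simp only [h, true_and, ne_eq, not_false_eq_true]
    · simp [h]
  simp only [h1]
  rw [Finset.sum_congr rfl fun f _ => h2 f]
  rw [Finset.sum_comm (f := fun f e => if f ≠ ⊥ ∧ f < e ∧ mid u f e = s ∧ br u e = t then
    δ (tr u f) else 0), ← Finset.sum_add_distrib]
  refine Finset.sum_congr rfl fun e _ => ?_
  rw [← Finset.sum_add_distrib]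
  refine Finset.sum_congr rfl fun f _ => ?_
  by_cases hef : e ≤ f
  · have : ¬ f < e := not_lt_of_ge hef
    simp [hef, this]
  · by_cases hfe : f ≤ e
    · have hlt : f < e := lt_of_le_not_ge hfe hef
      have hb : f ≠ ⊥ → e ≠ ⊥ := fun h h' => h (le_bot_iff.1 (h' ▸ hfe))
      rw [rest_of_le u hfe]
      simp only [hef, hfe, hlt, not_true, not_false_eq_true, and_false, false_and, if_false,
        true_and, zero_add]
      refine if_congr ?_ rfl rfl
      tauto
    · have hlt : ¬ f < e := fun h => hfe h.le
      rw [mid_of_not_le u hfe hef]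
      simp only [hef, hfe, hlt, not_false_eq_true, and_false, false_and, if_false,
        true_and, add_zero, and_true]
      refine if_congr ?_ rfl rfl
      tauto

theorem comm_dn_dn (s t : Tree) :
    dn s * dn t - dn t * dn s = ∑ᶠ r, ((alpha t r s : ℂ) - (alpha s r t : ℂ)) • dn r := by
  classical
  refine ext_δ fun u => ?_
  rw [wsum_sub (finite_alpha_mid _ _) (finite_alpha_mid _ _) dn]
  simp only [LinearMap.sub_apply, Module.End.mul_apply, dn_dn]
  rw [Finset.sum_comm]
  have : ∀ e f : u, (if (f ≠ ⊥ ∧ e ≠ ⊥) ∧ (¬ f ≤ e ∧ ¬ e ≤ f) ∧ br u f = t ∧ br u e = s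
        then δ (rest u e f) else 0) =
      (if (e ≠ ⊥ ∧ f ≠ ⊥) ∧ (¬ e ≤ f ∧ ¬ f ≤ e) ∧ br u e = s ∧ br u f = t
        then δ (rest u f e) else 0) := by
    intro e f
    rw [rest_comm u e f]
    refine if_congr ?_ rfl rfl
    tauto
  simp only [this]
  abel

/-! The mixed commutator. -/

/-- A descendant of `e` as a vertex of the tree of descendants. -/
def subMk {u : FinTree} {e v : u} (h : e ≤ v) : sub u e := ⟨v, h⟩

/-- A vertex which does not descend from `e`. -/
def trunkMk {u : FinTree} {e v : u} (he : e ≠ ⊥) (h : ¬ e ≤ v) : trunk u ⟨e, he⟩ := ⟨v, h⟩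

theorem br_join_left (u t : FinTree) (v e : u) (h : e ≤ v) :
    br (join u v t) (inl u v t e) = cl (join (sub u e) (subMk h) t) := by
  refine shape_eq (join (sub u e) (subMk h) t) ?_
  refine show Join (sub u e) t (subMk h) ≃o {y : Join u t v // Join.left e ≤ y} from
    { toFun := fun
        | .left x => ⟨.left x.1, x.2⟩
        | .right y => ⟨.right y, h⟩
      invFun := fun
        | ⟨.left x, hx⟩ => .left ⟨x, hx⟩
        | ⟨.right y, _⟩ => .right y
      left_inv := fun a => by rcases a with a | a <;> rfl
      right_inv := fun a => by rcases a with ⟨a | a, ha⟩ <;> rfl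
      map_rel_iff' := fun {a b} => by
        rcases a with a | a <;> rcases b with b | b <;> exact Iff.rfl }

theorem br_join_left' (u t : FinTree) (v e : u) (h : ¬ e ≤ v) :
    br (join u v t) (inl u v t e) = br u e :=
  (shape_subtype (Y := Join u t v) Join.left (fun _ _ _ _ => Iff.rfl)
    (fun _ _ h => by injection h) (fun _ hx => hx) (fun y hy => by
      rcases y with y | y
      · exact ⟨y, hy, rfl⟩
      · exact absurd hy h)).symm

theorem tr_join_left (u t : FinTree) (v e : u) (h : e ≤ v) :
    tr (join u v t) (inl u v t e) = tr u e :=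
  (shape_subtype (Y := Join u t v) Join.left (fun _ _ _ _ => Iff.rfl)
    (fun _ _ h => by injection h) (fun _ hx => hx) (fun y hy => by
      rcases y with y | y
      · exact ⟨y, hy, rfl⟩
      · exact absurd h hy)).symm

theorem tr_join_left' (u t : FinTree) (v e : u) (he : e ≠ ⊥) (h : ¬ e ≤ v) :
    tr (join u v t) (inl u v t e) = cl (join (trunk u ⟨e, he⟩) (trunkMk he h) t) := by
  refine shape_eq (join (trunk u ⟨e, he⟩) (trunkMk he h) t) ?_
  refine show Join (trunk u ⟨e, he⟩) t (trunkMk he h) ≃o {y : Join u t v // ¬ Join.left e ≤ y} from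
    { toFun := fun
        | .left x => ⟨.left x.1, x.2⟩
        | .right y => ⟨.right y, h⟩
      invFun := fun
        | ⟨.left x, hx⟩ => .left ⟨x, hx⟩
        | ⟨.right y, _⟩ => .right y
      left_inv := fun a => by rcases a with a | a <;> rfl
      right_inv := fun a => by rcases a with ⟨a | a, ha⟩ <;> rfl
      map_rel_iff' := fun {a b} => by
        rcases a with a | a <;> rcases b with b | b <;> exact Iff.rfl }

theorem br_join_right (u t : FinTree) (v : u) (y : t) :
    br (join u v t) (inr u v t y) = br t y :=
  (shape_subtype (Y := Join u t v) Join.right (fun _ _ _ _ => Iff.rfl)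
    (fun _ _ h => by injection h) (fun _ hx => hx) (fun z hz => by
      rcases z with z | z
      · exact absurd hz Join.right_le_left
      · exact ⟨z, hz, rfl⟩)).symm

theorem tr_join_right_bot (u t : FinTree) (v : u) :
    tr (join u v t) (inr u v t ⊥) = cl u := by
  refine shape_eq u ?_
  refine show u ≃o {y : Join u t v // ¬ Join.right ⊥ ≤ y} from
    { toFun := fun x => ⟨.left x, Join.right_le_left⟩
      invFun := fun
        | ⟨.left x, _⟩ => x
        | ⟨.right y, hy⟩ => absurd bot_le hy
      left_inv := fun a => rfl
      right_inv := fun a => by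
        rcases a with ⟨a | a, ha⟩
        · rfl
        · exact absurd bot_le ha
      map_rel_iff' := fun {a b} => Iff.rfl }

theorem tr_join_right (u t : FinTree) (v : u) (y : t) (hy : y ≠ ⊥) :
    tr (join u v t) (inr u v t y) = cl (join u v (trunk t ⟨y, hy⟩)) := by
  refine shape_eq (join u v (trunk t ⟨y, hy⟩)) ?_
  refine show Join u (trunk t ⟨y, hy⟩) v ≃o {z : Join u t v // ¬ Join.right y ≤ z} from
    { toFun := fun
        | .left x => ⟨.left x, Join.right_le_left⟩
        | .right z => ⟨.right z.1, z.2⟩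
      invFun := fun
        | ⟨.left x, _⟩ => .left x
        | ⟨.right z, hz⟩ => .right ⟨z, hz⟩
      left_inv := fun a => by rcases a with a | a <;> rfl
      right_inv := fun a => by rcases a with ⟨a | a, ha⟩ <;> rfl
      map_rel_iff' := fun {a b} => by
        rcases a with a | a <;> rcases b with b | b <;> exact Iff.rfl }

theorem br_bot (u : FinTree) : br u ⊥ = cl u :=
  shape_eq u
    { toFun := fun x => ⟨x, bot_le⟩
      invFun := fun x => x.1
      left_inv := fun _ => rfl
      right_inv := fun _ => rfl
      map_rel_iff' := Iff.rfl }

theorem left_eq_bot {u t : FinTree} {v e : u} :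
    inl u v t e = ⊥ ↔ e = ⊥ :=
  ⟨fun h => by injection h, fun h => congrArg Join.left h⟩

theorem right_ne_bot {u t : FinTree} {v : u} {y : t} :
    inr u v t y ≠ ⊥ := fun h => by injection h

theorem beta_br (s : Tree) (t u : FinTree) (e : u) :
    beta s (cl t) (br u e)
      = Nat.card {v : u // e ≤ v ∧ br (join u v t) (inl u v t e) = s} := by
  rw [← cl_sub, beta_cl]
  refine Nat.card_congr
    { toFun := fun v => ⟨v.1.1, v.1.2, (br_join_left u t v.1.1 e v.1.2).trans v.2⟩
      invFun := fun v => ⟨⟨v.1, v.2.1⟩, (br_join_left u t v.1 e v.2.1).symm.trans v.2.2⟩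
      left_inv := fun v => rfl
      right_inv := fun v => rfl }

open Classical in
theorem dn_up (s : Tree) (t u : FinTree) :
    dn s (up (cl t) (δ (cl u))) =
      up (cl t) (dn s (δ (cl u))) + (∑ᶠ r, (alpha s (cl t) r : ℂ) • up r) (δ (cl u)) +
        (∑ᶠ r, (beta s (cl t) r : ℂ) • dn r) (δ (cl u)) +
        (if s = cl t then gr (δ (cl u)) else 0) := by
  rw [wsum_dn (finite_beta_right _ _), wsum_alpha s t up, LinearMap.sum_apply, dn_δ s u, map_sum, up_δ,
    map_sum]
  simp only [dn_δ, sum_join, Finset.sum_add_distrib]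
  have h1 : (∑ v : u, ∑ y : t,
      if inr u v t y ≠ ⊥ ∧ br (join u v t) (inr u v t y) = s then
        δ (tr (join u v t) (inr u v t y)) else 0) =
      (∑ y : t, (if y ≠ ⊥ ∧ br t y = s then up (tr t y) else 0) (δ (cl u))) +
        (if s = cl t then gr (δ (cl u)) else 0) := by
    have h2 : ∀ y : t, (∑ v : u,
      if inr u v t y ≠ ⊥ ∧ br (join u v t) (inr u v t y) = s then
        δ (tr (join u v t) (inr u v t y)) else 0) =
      ((if y ≠ ⊥ ∧ br t y = s then up (tr t y) else 0) (δ (cl u))) +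
        (if y = ⊥ then (if s = cl t then gr (δ (cl u)) else 0) else 0) := by
      intro y
      simp only [br_join_right, ne_eq, right_ne_bot, not_false_eq_true, true_and]
      by_cases hy : y = ⊥
      · subst hy
        simp only [br_bot, tr_join_right_bot, not_true, false_and, if_false, if_true,
          LinearMap.zero_apply, zero_add, gr_δ, size_cl, eq_comm (a := s)]
        split_ifs
        · rw [Finset.sum_const, Finset.card_univ, ← Nat.card_eq_fintype_card, Nat.cast_smul_eq_nsmul]
        · simp
      · simp only [hy, not_false_eq_true, true_and, if_false, add_zero, tr_join_right u t _ y hy]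
        split_ifs
        · rw [← cl_trunk t ⟨y, hy⟩, up_δ]
        · simp
    rw [Finset.sum_comm, Finset.sum_congr rfl fun y _ => h2 y, Finset.sum_add_distrib]
    simp
  have h3 : (∑ v : u, ∑ e : u,
      if inl u v t e ≠ ⊥ ∧ br (join u v t) (inl u v t e) = s then
        δ (tr (join u v t) (inl u v t e)) else 0) =
      (∑ e : u, up (cl t) (if e ≠ ⊥ ∧ br u e = s then δ (tr u e) else 0)) +
      (∑ e : u, if e ≠ ⊥ then (beta s (cl t) (br u e) : ℂ) • δ (tr u e) else 0) := by
    rw [Finset.sum_comm, ← Finset.sum_add_distrib]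
    refine Finset.sum_congr rfl fun e _ => ?_
    by_cases he : e = ⊥
    · simp [left_eq_bot, he]
    · have h4 : up (cl t) (if e ≠ ⊥ ∧ br u e = s then δ (tr u e) else 0) =
          ∑ v : u, if ¬ e ≤ v then
            (if br u e = s then δ (tr (join u v t) (inl u v t e)) else 0) else 0 := by
        by_cases hs : br u e = s
        · simp only [hs, he, ne_eq, not_false_eq_true, and_self, if_true]
          rw [← cl_trunk u ⟨e, he⟩, up_δ]
          have := sum_subtype_ite (X := u) (fun v => ¬ e ≤ v)
            (Fintype.ofFinite (trunk u ⟨e, he⟩))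
            (fun v => δ (tr (join u v t) (inl u v t e)))
          refine Eq.trans ?_ this
          refine Fintype.sum_equiv (Equiv.refl _) _ _ fun v => ?_
          rw [Equiv.refl_apply, tr_join_left' u t v.1 e he v.2]
          rfl
        · simp [hs]
      rw [h4, if_pos he, beta_br, card_smul, ← Finset.sum_add_distrib]
      refine Finset.sum_congr rfl fun v _ => ?_
      simp only [ne_eq, left_eq_bot, he, not_false_eq_true, true_and]
      by_cases hv : e ≤ v
      · simp [hv, tr_join_left u t v e hv]
      · simp [hv, br_join_left' u t v e hv]
  rw [h1, h3]
  abel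

theorem gr_up (t : Tree) : gr * up t - up t * gr = (t.size : ℂ) • up t := by
  refine ext_δ fun u => ?_
  obtain ⟨t, rfl⟩ := exists_cl t
  simp only [LinearMap.sub_apply, Module.End.mul_apply, gr_δ, map_smul, up_δ, map_sum,
    LinearMap.smul_apply, size_cl, card_join, ← Finset.smul_sum, ← sub_smul]
  push_cast
  congr 1
  ring

theorem gr_dn (s : Tree) : gr * dn s - dn s * gr = -((s.size : ℂ) • dn s) := by
  classical
  refine ext_δ fun u => ?_
  simp only [LinearMap.sub_apply, Module.End.mul_apply, gr_δ, map_smul, dn_δ, map_sum,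
    LinearMap.smul_apply, LinearMap.neg_apply, Finset.smul_sum, ← Finset.sum_sub_distrib,
    ← Finset.sum_neg_distrib]
  refine Finset.sum_congr rfl fun x _ => ?_
  by_cases h : x ≠ ⊥ ∧ br u x = s
  · rw [if_pos h, gr_δ, ← size_br_add_size_tr u h.1, h.2, ← sub_smul, ← neg_smul]
    push_cast
    congr 1
    ring
  · simp [h]

theorem comm_dn_up [DecidableEq Tree] (s t : Tree) :
    dn s * up t - up t * dn s =
      if s = t then gr else (∑ᶠ r, (alpha s t r : ℂ) • up r) + ∑ᶠ r, (beta s t r : ℂ) • dn r := by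
  refine ext_δ fun u => ?_
  obtain ⟨t, rfl⟩ := exists_cl t
  rw [LinearMap.sub_apply, Module.End.mul_apply, Module.End.mul_apply, dn_up]
  split_ifs with h
  · subst h
    have pos : ∀ r : Tree, 0 < r.size := fun r => card_pos _
    have h1 : ∀ r, alpha (cl t) (cl t) r = 0 := fun r => by
      by_contra hne
      have := alpha_ne_zero hne
      have := pos r
      omega
    have h2 : ∀ r, beta (cl t) (cl t) r = 0 := fun r => by
      by_contra hne
      have := beta_ne_zero hne
      have := pos r
      omega
    simp [h1, h2]
  · simp only [LinearMap.add_apply]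
    abel

/-- The action of the insertion-elimination algebra on the span of rooted trees. -/
noncomputable def rho : InsElim →ₗ[ℂ] Module.End ℂ TreeSpace :=
  stdBasis.constr ℂ fun
    | .d => gr
    | .plus t => up t
    | .minus s => dn s

theorem rho_d : rho d = gr := stdBasis.constr_basis ℂ _ _
theorem rho_Dplus (t : Tree) : rho (Dplus t) = up t := stdBasis.constr_basis ℂ _ _
theorem rho_Dminus (t : Tree) : rho (Dminus t) = dn t := stdBasis.constr_basis ℂ _ _

theorem bracket_basis (i j : Index) : bracket (stdBasis i) (stdBasis j) = basisBracket i j := by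
  simp [bracket]

theorem bb_plus_plus (s t : Tree) : basisBracket (.plus s) (.plus t)
    = ∑ᶠ r : Tree, ((beta r s t : ℂ) - (beta r t s : ℂ)) • Dplus r := rfl

theorem bb_minus_minus (s t : Tree) : basisBracket (.minus s) (.minus t)
    = ∑ᶠ r : Tree, ((alpha t r s : ℂ) - (alpha s r t : ℂ)) • Dminus r := rfl

theorem bb_minus_plus [DecidableEq Tree] (s t : Tree) : basisBracket (.minus s) (.plus t)
    = if s = t then d
      else (∑ᶠ r : Tree, (alpha s t r : ℂ) • Dplus r) +
        ∑ᶠ r : Tree, (beta s t r : ℂ) • Dminus r := by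
  unfold basisBracket
  by_cases h : s = t <;> simp [h]

theorem bb_plus_minus (s t : Tree) :
    basisBracket (.plus t) (.minus s) = -basisBracket (.minus s) (.plus t) := rfl

theorem bb_d_plus (t : Tree) : basisBracket .d (.plus t) = (t.size : ℂ) • Dplus t := rfl

theorem bb_d_minus (t : Tree) : basisBracket .d (.minus t) = -((t.size : ℂ) • Dminus t) := rfl

theorem bb_plus_d (t : Tree) : basisBracket (.plus t) .d = -((t.size : ℂ) • Dplus t) := rfl

theorem bb_minus_d (t : Tree) : basisBracket (.minus t) .d = (t.size : ℂ) • Dminus t := rfl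

theorem bb_d_d : basisBracket .d .d = 0 := rfl

theorem rho_basisBracket (i j : Index) :
    rho (basisBracket i j)
      = rho (stdBasis i) * rho (stdBasis j) - rho (stdBasis j) * rho (stdBasis i) := by
  have hmix : ∀ s t, rho (basisBracket (.minus s) (.plus t)) = dn s * up t - up t * dn s := by
    classical
    intro s t
    rw [comm_dn_up, bb_minus_plus]
    split_ifs
    · exact rho_d
    · rw [map_add, map_wsum (finite_alpha_right _ _), map_wsum (finite_beta_right _ _)]
      simp only [rho_Dplus, rho_Dminus]
  cases i with
  | d =>
    cases j with
    | d => rw [bb_d_d, map_zero, sub_self]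
    | plus t =>
      change _ = rho d * rho (Dplus t) - rho (Dplus t) * rho d
      rw [rho_d, rho_Dplus, gr_up, bb_d_plus, map_smul, rho_Dplus]
    | minus t =>
      change _ = rho d * rho (Dminus t) - rho (Dminus t) * rho d
      rw [rho_d, rho_Dminus, gr_dn, bb_d_minus, map_neg, map_smul, rho_Dminus]
  | plus s =>
    cases j with
    | d =>
      change _ = rho (Dplus s) * rho d - rho d * rho (Dplus s)
      rw [rho_d, rho_Dplus, ← neg_sub, gr_up, bb_plus_d, map_neg, map_smul, rho_Dplus]
    | plus t =>
      change _ = rho (Dplus s) * rho (Dplus t) - rho (Dplus t) * rho (Dplus s)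
      rw [rho_Dplus, rho_Dplus, comm_up_up, bb_plus_plus]
      rw [wsum_sub (finite_beta_left _ _) (finite_beta_left _ _), map_sub,
        map_wsum (finite_beta_left _ _), map_wsum (finite_beta_left _ _),
        wsum_sub (finite_beta_left _ _) (finite_beta_left _ _) up]
      simp only [rho_Dplus]
    | minus t =>
      change _ = rho (Dplus s) * rho (Dminus t) - rho (Dminus t) * rho (Dplus s)
      rw [rho_Dplus, rho_Dminus, ← neg_sub, ← hmix, ← map_neg, bb_plus_minus]
  | minus s =>
    cases j with
    | d =>
      change _ = rho (Dminus s) * rho d - rho d * rho (Dminus s)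
      rw [rho_d, rho_Dminus, ← neg_sub, gr_dn, bb_minus_d, map_smul, rho_Dminus, neg_neg]
    | plus t =>
      change _ = rho (Dminus s) * rho (Dplus t) - rho (Dplus t) * rho (Dminus s)
      rw [rho_Dplus, rho_Dminus, hmix]
    | minus t =>
      change _ = rho (Dminus s) * rho (Dminus t) - rho (Dminus t) * rho (Dminus s)
      rw [rho_Dminus, rho_Dminus, comm_dn_dn, bb_minus_minus]
      rw [wsum_sub (finite_alpha_mid _ _) (finite_alpha_mid _ _), map_sub,
        map_wsum (finite_alpha_mid _ _), map_wsum (finite_alpha_mid _ _),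
        wsum_sub (finite_alpha_mid _ _) (finite_alpha_mid _ _) dn]
      simp only [rho_Dminus]

theorem rho_bracket (x y : InsElim) : rho (bracket x y) = rho x * rho y - rho y * rho x := by
  have h : bracket.compr₂ rho =
      (LinearMap.mul ℂ (Module.End ℂ TreeSpace)).compl₁₂ rho rho -
        ((LinearMap.mul ℂ (Module.End ℂ TreeSpace)).compl₁₂ rho rho).flip := by
    refine stdBasis.ext fun i => stdBasis.ext fun j => ?_
    simp only [LinearMap.compr₂_apply, LinearMap.sub_apply, LinearMap.compl₁₂_apply,
      LinearMap.flip_apply, LinearMap.mul_apply', bracket_basis, rho_basisBracket]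
  exact LinearMap.congr_fun₂ h x y

/-! #### Faithfulness -/

theorem coord_δ [DecidableEq Tree] (q r : Tree) : δ.coord q (δ r) = if r = q then 1 else 0 := by
  simp [Finsupp.single_apply]

theorem coord_wsum {a : Tree → ℕ} (ha : (Function.support a).Finite) (q : Tree) :
    δ.coord q (∑ᶠ r, (a r : ℂ) • δ r) = (a q : ℂ) := by
  classical
  rw [wsum_eq ha, map_sum]
  simp only [map_smul, coord_δ, smul_eq_mul, mul_ite, mul_one, mul_zero, Finset.sum_ite_eq']
  split_ifs with h
  · rfl
  · have : a q = 0 := by simpa using h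
    simp [this]

theorem up_δ_apply (t u r : Tree) : δ.coord r (up t (δ u)) = (beta r t u : ℂ) := by
  rw [up, lc_δ, coord_wsum (finite_beta_left _ _)]

theorem dn_δ_apply (s u r : Tree) : δ.coord r (dn s (δ u)) = (alpha s u r : ℂ) := by
  rw [dn, lc_δ, coord_wsum (finite_alpha_right _ _)]

theorem size_pos (t : Tree) : 0 < t.size := card_pos _

theorem size_onePoint : (cl onePoint).size = 1 := by
  rw [size_cl]
  exact Nat.card_unique (α := PUnit)

/-- The tree whose root has a single child, at which a copy of `t` is attached. -/
noncomputable def stem (t : FinTree) : Tree := cl (join onePoint ⊥ t)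

theorem size_stem (t : FinTree) : (stem t).size = 1 + (cl t).size := by
  rw [← size_onePoint, stem, size_cl, size_cl, size_cl, card_join]

theorem tr_stem {t : FinTree} {x : join onePoint ⊥ t} (hx : x ≠ ⊥)
    (h : tr (join onePoint ⊥ t) x = cl onePoint) : x = inr onePoint ⊥ t ⊥ := by
  rcases x with x | y
  · exact absurd rfl hx
  · by_cases hy : y = ⊥
    · subst hy; rfl
    · have h1 := tr_join_right onePoint t ⊥ y hy
      have h2 := congrArg Tree.size (h1.symm.trans h)
      rw [size_cl, card_join, ← size_cl, size_onePoint] at h2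
      have := card_pos (trunk t ⟨y, hy⟩)
      omega

theorem alpha_stem (s : Tree) (t : FinTree) [Decidable (s = cl t)] :
    alpha s (stem t) (cl onePoint) = if s = cl t then 1 else 0 := by
  rw [stem, alpha_cl]
  split_ifs with h
  · subst h
    rw [Nat.card_eq_one_iff_unique]
    refine ⟨⟨fun a b => Subtype.ext ?_⟩, ⟨⟨inr onePoint ⊥ t ⊥, tr_join_right_bot _ _ _,
      right_ne_bot, (br_join_right _ _ _ _).trans (br_bot t)⟩⟩⟩
    rw [tr_stem a.2.2.1 a.2.1, tr_stem b.2.2.1 b.2.1]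
  · rw [Nat.card_eq_zero]
    refine .inl ⟨fun a => h ?_⟩
    have h1 := a.2.2.2
    rw [tr_stem a.2.2.1 a.2.1, br_join_right, br_bot] at h1
    exact h1.symm

theorem stem_injective {s t : FinTree} (h : stem s = stem t) : cl s = cl t := by
  classical
  have h1 := alpha_stem (cl s) s
  rw [h, alpha_stem] at h1
  by_contra hne
  simp [hne] at h1

theorem beta_stem (s t : FinTree) [Decidable (cl s = cl t)] :
    beta (stem t) (cl s) (cl onePoint) = if cl s = cl t then 1 else 0 := by
  rw [beta_cl]
  have hv : ∀ v : onePoint, cl (join onePoint v s) = stem s := fun v => rfl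
  simp only [hv]
  split_ifs with h
  · have : stem s = stem t := by
      obtain ⟨e⟩ := cl_eq_cl.1 h
      exact cl_eq_cl.2 ⟨joinCongr (OrderIso.refl _) e ⊥⟩
    rw [Nat.card_eq_one_iff_unique]
    exact ⟨⟨fun a b => Subtype.ext rfl⟩, ⟨⟨⊥, this⟩⟩⟩
  · rw [Nat.card_eq_zero]
    exact .inl ⟨fun a => h (stem_injective a.2)⟩

theorem gr_δ_apply (u r : Tree) (h : u.size ≠ r.size) : δ.coord r (gr (δ u)) = 0 := by
  classical
  rw [gr_δ, map_smul, coord_δ, if_neg fun h' => h (congrArg _ h'), smul_zero]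

theorem rho_injective : Function.Injective rho := by
  classical
  rw [injective_iff_map_eq_zero]
  intro x hx
  have hd : (δ.coord (cl onePoint)) ∘ₗ (LinearMap.applyₗ (δ (cl onePoint))) ∘ₗ rho
      = stdBasis.coord .d := by
    refine stdBasis.ext fun i => ?_
    rw [LinearMap.comp_apply, LinearMap.comp_apply, LinearMap.applyₗ_apply_apply,
      stdBasis.coord_apply, Module.Basis.repr_self]
    rcases i with _ | t | t
    · change δ.coord _ (rho d _) = _
      rw [rho_d, gr_δ]
      simp [size_onePoint]
    · change δ.coord _ (rho (Dplus t) _) = _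
      have : beta (cl onePoint) t (cl onePoint) = 0 := by
        by_contra hne
        have := beta_ne_zero hne
        have := size_pos t
        omega
      rw [rho_Dplus, up_δ_apply, this]
      simp
    · change δ.coord _ (rho (Dminus t) _) = _
      have : alpha t (cl onePoint) (cl onePoint) = 0 := by
        by_contra hne
        have := alpha_ne_zero hne
        have := size_pos t
        omega
      rw [rho_Dminus, dn_δ_apply, this]
      simp
  have hp : ∀ t, (δ.coord (stem t)) ∘ₗ (LinearMap.applyₗ (δ (cl onePoint))) ∘ₗ rho
      = stdBasis.coord (.plus (cl t)) := by
    intro t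
    have hs := size_stem t
    have h1 := size_onePoint
    have h2 := size_pos (cl t)
    refine stdBasis.ext fun i => ?_
    rw [LinearMap.comp_apply, LinearMap.comp_apply, LinearMap.applyₗ_apply_apply,
      stdBasis.coord_apply, Module.Basis.repr_self]
    rcases i with _ | s | s
    · change δ.coord _ (rho d _) = _
      rw [rho_d, gr_δ_apply _ _ (by omega)]
      simp
    · change δ.coord _ (rho (Dplus s) _) = _
      obtain ⟨s, rfl⟩ := exists_cl s
      rw [rho_Dplus, up_δ_apply, beta_stem, Finsupp.single_apply]
      simp
    · change δ.coord _ (rho (Dminus s) _) = _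
      have : alpha s (cl onePoint) (stem t) = 0 := by
        by_contra hne
        have := alpha_ne_zero hne
        omega
      rw [rho_Dminus, dn_δ_apply, this]
      simp
  have hm : ∀ t, (δ.coord (cl onePoint)) ∘ₗ (LinearMap.applyₗ (δ (stem t))) ∘ₗ rho
      = stdBasis.coord (.minus (cl t)) := by
    intro t
    have hs := size_stem t
    have h1 := size_onePoint
    have h2 := size_pos (cl t)
    refine stdBasis.ext fun i => ?_
    rw [LinearMap.comp_apply, LinearMap.comp_apply, LinearMap.applyₗ_apply_apply,
      stdBasis.coord_apply, Module.Basis.repr_self]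
    rcases i with _ | s | s
    · change δ.coord _ (rho d _) = _
      rw [rho_d, gr_δ_apply _ _ (by omega)]
      simp
    · change δ.coord _ (rho (Dplus s) _) = _
      have : beta (cl onePoint) s (stem t) = 0 := by
        by_contra hne
        have := beta_ne_zero hne
        omega
      rw [rho_Dplus, up_δ_apply, this]
      simp
    · change δ.coord _ (rho (Dminus s) _) = _
      rw [rho_Dminus, dn_δ_apply, alpha_stem, Finsupp.single_apply]
      simp
  have key : ∀ i, stdBasis.coord i x = 0 := by
    intro i
    rcases i with _ | t | t
    · rw [← hd]; simp [hx]
    · obtain ⟨t, rfl⟩ := exists_cl t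
      rw [← hp]; simp [hx]
    · obtain ⟨t, rfl⟩ := exists_cl t
      rw [← hm]; simp [hx]
  exact (stdBasis.forall_coord_eq_zero_iff).1 key

/-! ### The Lie algebra structure and its automorphisms -/

/-- The insertion-elimination algebra is a Lie ring. -/
noncomputable instance : LieRing InsElim where
  bracket x y := bracket x y
  add_lie x y z := by rw [map_add, LinearMap.add_apply]
  lie_add x y z := by rw [map_add]
  lie_self x := rho_injective (by rw [rho_bracket, sub_self, map_zero])
  leibniz_lie x y z := rho_injective (by
    simp only [map_add, rho_bracket]
    noncomm_ring)

/-- The insertion-elimination algebra is a complex Lie algebra. -/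
noncomputable instance : LieAlgebra ℂ InsElim where
  lie_smul c x y := by simp [Bracket.bracket]

theorem lie_basis (i j : Index) : ⁅stdBasis i, stdBasis j⁆ = basisBracket i j :=
  bracket_basis i j

/-- The automorphisms of a Lie algebra form a group under composition. -/
instance lieEquivGroup {R L : Type*} [CommRing R] [LieRing L] [LieAlgebra R L] :
    Group (L ≃ₗ⁅R⁆ L) where
  mul f g := g.trans f
  one := 1
  inv f := f.symm
  mul_assoc _ _ _ := rfl
  one_mul _ := by ext; rfl
  mul_one _ := by ext; rfl
  inv_mul_cancel f := LieEquiv.ext fun x => f.symm_apply_apply x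

/-- The scalar by which `τ_ζ` acts on a basis vector: `τ_ζ(d) = d`, `τ_ζ(D_t^+) = ζ^{|t|} D_t^+` and
`τ_ζ(D_t^-) = ζ^{-|t|} D_t^-`. -/
noncomputable def tauScalar (ζ : ℂˣ) : Index → ℂ
  | .d => 1
  | .plus t => (ζ : ℂ) ^ (t.size : ℤ)
  | .minus t => (ζ : ℂ) ^ (-(t.size : ℤ))

/-- The linear map `τ_ζ`. -/
noncomputable def tauLin (ζ : ℂˣ) : InsElim →ₗ[ℂ] InsElim :=
  stdBasis.constr ℂ fun i => tauScalar ζ i • stdBasis i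

theorem tauLin_basis (ζ : ℂˣ) (i : Index) :
    tauLin ζ (stdBasis i) = tauScalar ζ i • stdBasis i := stdBasis.constr_basis ℂ _ _

theorem tauScalar_mul (ζ ξ : ℂˣ) (i : Index) :
    tauScalar (ζ * ξ) i = tauScalar ζ i * tauScalar ξ i := by
  cases i <;> simp [tauScalar, mul_pow, mul_comm]

theorem tauLin_comp (ζ ξ : ℂˣ) : tauLin ζ ∘ₗ tauLin ξ = tauLin (ζ * ξ) := by
  refine stdBasis.ext fun i => ?_
  simp [tauLin_basis, tauScalar_mul, smul_smul, mul_comm]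

theorem tauLin_one : tauLin 1 = LinearMap.id := by
  refine stdBasis.ext fun i => ?_
  rw [tauLin_basis]
  cases i <;> simp [tauScalar]

theorem tauLin_wsum (ζ : ℂˣ) {a : Tree → ℕ} (ha : (Function.support a).Finite) (k : Tree → Index)
    (c : ℂ) (h : ∀ r, a r ≠ 0 → tauScalar ζ (k r) = c) :
    tauLin ζ (∑ᶠ r, (a r : ℂ) • stdBasis (k r)) = c • ∑ᶠ r, (a r : ℂ) • stdBasis (k r) := by
  have := map_wsum ha (fun r => stdBasis (k r)) (LinearMap.lsmul ℂ InsElim c)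
  simp only [LinearMap.lsmul_apply] at this
  rw [this, map_wsum ha]
  refine finsum_congr fun r => ?_
  by_cases hr : a r = 0
  · simp [hr]
  · rw [tauLin_basis, h r hr]

theorem tauLin_basisBracket (ζ : ℂˣ) (i j : Index) :
    tauLin ζ (basisBracket i j) = (tauScalar ζ i * tauScalar ζ j) • basisBracket i j := by
  have hζ : (ζ : ℂ) ≠ 0 := ζ.ne_zero
  have hd : tauLin ζ d = d := (tauLin_basis ζ .d).trans (one_smul _ _)
  have hp : ∀ t, tauLin ζ (Dplus t) = (ζ : ℂ) ^ (t.size : ℤ) • Dplus t := fun t =>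
    tauLin_basis ζ (.plus t)
  have hm : ∀ t, tauLin ζ (Dminus t) = (ζ : ℂ) ^ (-(t.size : ℤ)) • Dminus t := fun t =>
    tauLin_basis ζ (.minus t)
  have hmix : ∀ s t, tauLin ζ (basisBracket (.minus s) (.plus t)) =
      (tauScalar ζ (.minus s) * tauScalar ζ (.plus t)) • basisBracket (.minus s) (.plus t) := by
    classical
    intro s t
    simp only [tauScalar]
    rw [← zpow_add₀ hζ, bb_minus_plus]
    split_ifs with h
    · subst h
      simp [hd]
    · rw [map_add, smul_add]
      refine congrArg₂ _ (tauLin_wsum ζ (finite_alpha_right s t) .plus _ fun r hr => ?_)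
        (tauLin_wsum ζ (finite_beta_right s t) .minus _ fun r hr => ?_)
      · simp only [tauScalar]
        congr 1
        have := alpha_ne_zero hr
        omega
      · simp only [tauScalar]
        congr 1
        have := beta_ne_zero hr
        omega
  rcases i with _ | s | s <;> rcases j with _ | t | t
  · rw [bb_d_d, map_zero, smul_zero]
  · rw [bb_d_plus, map_smul, hp, smul_comm]
    simp only [tauScalar, one_mul]
  · rw [bb_d_minus, map_neg, map_smul, hm, smul_comm, smul_neg]
    simp only [tauScalar, one_mul]
  · rw [bb_plus_d, map_neg, map_smul, hp, smul_comm, smul_neg]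
    simp only [tauScalar, mul_one]
  · simp only [tauScalar]
    rw [← zpow_add₀ hζ, bb_plus_plus]
    rw [wsum_sub (finite_beta_left _ _) (finite_beta_left _ _), map_sub, smul_sub]
    refine congrArg₂ _ (tauLin_wsum ζ (finite_beta_left _ _) .plus _ fun r hr => ?_)
      (tauLin_wsum ζ (finite_beta_left _ _) .plus _ fun r hr => ?_) <;>
    · simp only [tauScalar]
      congr 1
      have := beta_ne_zero hr
      omega
  · have := hmix t s
    change tauLin ζ (-basisBracket (.minus t) (.plus s)) = _ • -basisBracket (.minus t) (.plus s)
    rw [map_neg, this, smul_neg, mul_comm]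
  · rw [bb_minus_d, map_smul, hm, smul_comm]
    simp only [tauScalar, mul_one]
  · exact hmix s t
  · simp only [tauScalar]
    rw [← zpow_add₀ hζ, bb_minus_minus]
    rw [wsum_sub (finite_alpha_mid _ _) (finite_alpha_mid _ _), map_sub, smul_sub]
    refine congrArg₂ _ (tauLin_wsum ζ (finite_alpha_mid _ _) .minus _ fun r hr => ?_)
      (tauLin_wsum ζ (finite_alpha_mid _ _) .minus _ fun r hr => ?_) <;>
    · simp only [tauScalar]
      congr 1
      have := alpha_ne_zero hr
      omega

theorem tauLin_lie (ζ : ℂˣ) (x y : InsElim) : tauLin ζ ⁅x, y⁆ = ⁅tauLin ζ x, tauLin ζ y⁆ := by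
  have h : bracket.compr₂ (tauLin ζ) = bracket.compl₁₂ (tauLin ζ) (tauLin ζ) := by
    refine stdBasis.ext fun i => stdBasis.ext fun j => ?_
    simp only [LinearMap.compr₂_apply, LinearMap.compl₁₂_apply, tauLin_basis, map_smul,
      LinearMap.smul_apply, bracket_basis, tauLin_basisBracket, smul_smul]
    rw [mul_comm]
  exact LinearMap.congr_fun₂ h x y

/-- The automorphism `τ_ζ` of the insertion-elimination algebra, for a nonzero complex number `ζ`:
`τ_ζ(d) = d`, `τ_ζ(D_t^+) = ζ^{|t|} D_t^+` and `τ_ζ(D_t^-) = ζ^{-|t|} D_t^-`. -/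
noncomputable def tau (ζ : ℂˣ) : InsElim ≃ₗ⁅ℂ⁆ InsElim where
  toFun := tauLin ζ
  map_add' := (tauLin ζ).map_add
  map_smul' := (tauLin ζ).map_smul
  map_lie' {x y} := tauLin_lie ζ x y
  invFun := tauLin ζ⁻¹
  left_inv x := by
    rw [← LinearMap.comp_apply, tauLin_comp, inv_mul_cancel, tauLin_one, LinearMap.id_apply]
  right_inv x := by
    rw [← LinearMap.comp_apply, tauLin_comp, mul_inv_cancel, tauLin_one, LinearMap.id_apply]

theorem tau_d (ζ : ℂˣ) : tau ζ d = d := (tauLin_basis ζ .d).trans (one_smul _ _)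

theorem tau_Dplus (ζ : ℂˣ) (t : Tree) : tau ζ (Dplus t) = (ζ : ℂ) ^ (t.size : ℤ) • Dplus t :=
  tauLin_basis ζ (.plus t)

theorem tau_Dminus (ζ : ℂˣ) (t : Tree) :
    tau ζ (Dminus t) = (ζ : ℂ) ^ (-(t.size : ℤ)) • Dminus t :=
  tauLin_basis ζ (.minus t)

end InsertionElimination

namespace InsertionElimination

/-! ### Decomposing a tree along an edge -/

/-! Grade `InsElim` by the eigenvalues of `ad d`: `D_t^+` has weight `|t|` and `D_t^-` has weight
`-|t|`. The proof compares automorphisms with this grading, and tests central ones against the `τ_ζ`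
and a Chevalley involution `omega`.

The involution: counting isomorphisms in two ways gives `β(r,t,u)·|Aut r| = α(t,r,u)·|Aut t|·|Aut
u|` (`beta_mul_aut`). Hence, for the form on the span of trees with `⟨t,t⟩ = |Aut t|` and distinct
trees orthogonal, inserting `t` is adjoint to `|Aut t|` times eliminating `t`. Minus the adjoint
respects commutators, and `rho` is faithful, so this defines an automorphism `omega` exchanging
`D_t^+` and `D_t^-` up to scalars.

Every automorphism `φ` sends `d` to `±d` (`map_d_eq_or_neg`). As `ad d` is diagonal, `ad (φ d)` is
locally finite. If `φ d` had a component `D_t^+`, choose `t` of largest size; repeated brackets with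
`φ d` would then produce roots carrying ever more copies of `t`, with nonzero coefficients.
Composing with `omega` excludes the `D_t^-` as well, so `φ d = c • d`; integrality of the weights
for `φ` and its inverse forces `c = ±1`. Thus `φ` maps weight `m` to weight `±m`, where `τ_{-1}`
acts by the same sign: `τ_{-1}` is central.

Conversely let `φ` be central. Commuting with `τ_2`, it preserves weights; the space of weight one
is a line, so `φ` multiplies `D^+` of the one-vertex tree by some `c`. Commuting with `omega`, it
multiplies the corresponding `D^-` by the same `c`, so `φ d = c² d` and `c³ = c`, that is `c = ±1`.
After multiplication by `τ_{-1}` one may take `c = 1`. By induction on `|t|`, the vector `φ(D_t^-) -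
D_t^-` of weight `-|t|` commutes with all `D_s^+`, `|s| < |t|`. Its coefficients form a functional
that kills all insertions, and the insertions span all trees with more than one vertex
(`eq_zero_of_up_eq_zero`), so it vanishes; `omega` transfers the conclusion to `D_t^+`. -/

theorem le_pred_iff_of_not_le {r : FinTree} {x y z : r} (hz : x ≤ z) (hy : ¬ x ≤ y) :
    y ≤ Order.pred x ↔ y ≤ z := by
  refine ⟨fun h => (h.trans (Order.pred_le x)).trans hz, fun h => ?_⟩
  -- The ancestors of a vertex form a chain, so `x` and `y` are comparable.
  have hyx : y ≤ x := (le_total_of_directed h hz).resolve_left hy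
  exact Order.le_pred_of_lt (lt_of_le_not_ge hyx hy)

theorem not_le_pred {r : FinTree} {x : r} (hx : x ≠ ⊥) : ¬ x ≤ Order.pred x := fun h =>
  hx (Order.le_pred_iff_isMin.1 h).eq_bot

/-- A tree is recovered from the two parts into which an edge divides it, transported along
isomorphisms with trees `u` and `t`. -/
noncomputable def glue {r u t : FinTree} {x : r} (hx : x ≠ ⊥)
    (f : u ≃o {y : r // ¬ x ≤ y}) (g : t ≃o {y : r // x ≤ y}) :
    join u (f.symm ⟨Order.pred x, not_le_pred hx⟩) t ≃o r := by
  classical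
  exact show Join u t (f.symm ⟨Order.pred x, not_le_pred hx⟩) ≃o r from
  { toFun := fun
      | .left a => (f a).1
      | .right b => (g b).1
    invFun := fun y => if h : x ≤ y then .right (g.symm ⟨y, h⟩) else .left (f.symm ⟨y, h⟩)
    left_inv := fun a => by
      rcases a with a | b
      · simp [(f a).2]
      · simp [(g b).2]
    right_inv := fun y => by
      by_cases h : x ≤ y <;> simp [h]
    map_rel_iff' := fun {a b} => by
      rcases a with a | a <;> rcases b with b | b
      · exact f.le_iff_le
      · change (f a).1 ≤ (g b).1 ↔ a ≤ f.symm _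
        rw [OrderIso.le_symm_apply]
        exact (le_pred_iff_of_not_le (g b).2 (f a).2).symm
      · change (g a).1 ≤ (f b).1 ↔ False
        exact iff_false_intro fun h => (f b).2 ((g a).2.trans h)
      · exact g.le_iff_le }

/-- The isomorphism of the first part of `join u v t` with a part of `r` which is induced by an
isomorphism of the two trees. -/
noncomputable def joinIsoLeft {r u t : FinTree} {v : u} (e : join u v t ≃o r) :
    u ≃o {y : r // ¬ e (inr u v t ⊥) ≤ y} where
  toEquiv := Equiv.ofBijective
    (fun a => ⟨e (inl u v t a), fun h => Join.right_le_left (e.le_iff_le.1 h)⟩) (by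
      refine ⟨fun a b h => ?_, fun ⟨y, hy⟩ => ?_⟩
      · have := e.injective (congrArg Subtype.val h)
        injection this
      · obtain ⟨z, rfl⟩ := e.surjective y
        rcases z with a | b
        · exact ⟨a, rfl⟩
        · exact absurd (e.le_iff_le.2 (show inr u v t ⊥ ≤ inr u v t b from
            Join.right_le_right.2 bot_le)) hy)
  map_rel_iff' {a b} := (e.le_iff_le : e (inl u v t a) ≤ e (inl u v t b) ↔ _)

/-- The isomorphism of the second part of `join u v t` with a part of `r` which is induced by an
isomorphism of the two trees. -/
noncomputable def joinIsoRight {r u t : FinTree} {v : u} (e : join u v t ≃o r) :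
    t ≃o {y : r // e (inr u v t ⊥) ≤ y} where
  toEquiv := Equiv.ofBijective
    (fun a => ⟨e (inr u v t a), e.le_iff_le.2 (Join.right_le_right.2 bot_le)⟩) (by
      refine ⟨fun a b h => ?_, fun ⟨y, hy⟩ => ?_⟩
      · have := e.injective (congrArg Subtype.val h)
        injection this
      · obtain ⟨z, rfl⟩ := e.surjective y
        rcases z with a | b
        · exact absurd (e.le_iff_le.1 hy) Join.right_le_left
        · exact ⟨b, rfl⟩)
  map_rel_iff' {a b} := (e.le_iff_le : e (inr u v t a) ≤ e (inr u v t b) ↔ _)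

/-! ### Symmetry factors -/

/-- The number of automorphisms of a tree. -/
noncomputable def Tree.aut (t : Tree) : ℕ := Nat.card (t.rep ≃o t.rep)

instance (s t : FinTree) : Finite (s ≃o t) :=
  Finite.of_injective (fun e : s ≃o t => (e : s → t)) DFunLike.coe_injective

theorem aut_ne_zero (t : Tree) : t.aut ≠ 0 :=
  Nat.card_ne_zero.2 ⟨⟨OrderIso.refl _⟩, inferInstance⟩

theorem card_iso {s t : FinTree} (h : cl s = cl t) : Nat.card (s ≃o t) = (cl t).aut := by
  obtain ⟨e⟩ := cl_eq_cl.1 (h.trans (cl_rep (cl t)).symm)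
  obtain ⟨f⟩ := cl_eq_cl.1 (cl_rep (cl t))
  exact Nat.card_congr
    { toFun := fun g => (e.symm.trans g).trans f.symm
      invFun := fun g => (e.trans g).trans f
      left_inv := fun g => by ext; simp
      right_inv := fun g => by ext; simp }

theorem card_iso_of_ne {s t : FinTree} (h : cl s ≠ cl t) : Nat.card (s ≃o t) = 0 :=
  Nat.card_eq_zero.2 (.inl ⟨fun e => h (cl_eq_cl.2 ⟨e⟩)⟩)

/-- For each `v` giving the class of `r`, the isomorphisms form a torsor under the automorphisms of
`r`; for the other `v` there are none. -/
theorem card_iso_join (r u t : FinTree) :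
    Nat.card (Σ v : u, join u v t ≃o r) = beta (cl r) (cl t) (cl u) * (cl r).aut := by
  classical
  rw [Nat.card_sigma, beta_cl, Nat.card_eq_fintype_card, Fintype.card_subtype,
    Finset.card_eq_sum_ones, Finset.sum_mul, Finset.sum_filter]
  refine Finset.sum_congr rfl fun v _ => ?_
  split_ifs with h
  · rw [card_iso h, one_mul]
  · exact card_iso_of_ne h

theorem card_iso_cut (r u t : FinTree) :
    Nat.card (Σ x : Edge r, (u ≃o trunk r x) × (t ≃o branch r x))
      = alpha (cl t) (cl r) (cl u) * ((cl t).aut * (cl u).aut) := by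
  classical
  have h1 : alpha (cl t) (cl r) (cl u) =
      Nat.card {x : Edge r // cl (trunk r x) = cl u ∧ cl (branch r x) = cl t} := by
    simp only [alpha_cl, cl_trunk, cl_branch]
    exact Nat.card_congr
      { toFun := fun x => ⟨⟨x.1, x.2.2.1⟩, x.2.1, x.2.2.2⟩
        invFun := fun x => ⟨x.1.1, x.2.1, x.1.2, x.2.2⟩
        left_inv := fun _ => rfl
        right_inv := fun _ => rfl }
  rw [Nat.card_sigma, h1, Nat.card_eq_fintype_card, Fintype.card_subtype,
    Finset.card_eq_sum_ones, Finset.sum_mul, Finset.sum_filter]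
  refine Finset.sum_congr rfl fun x _ => ?_
  rw [Nat.card_prod]
  split_ifs with h
  · rw [card_iso h.1.symm, card_iso h.2.symm, h.1, h.2, one_mul, mul_comm]
  · rcases not_and_or.1 h with h | h
    · rw [card_iso_of_ne (Ne.symm h), zero_mul]
    · rw [card_iso_of_ne (Ne.symm h), mul_zero]

/-- Both sides count the ways of exhibiting `r` as a copy of `u` with a copy of `t` grafted on it:
each embeds into the pairs of maps `u → r`, `t → r`, and the two images coincide. -/
theorem card_iso_join_eq_card_iso_cut (r u t : FinTree) :
    Nat.card (Σ v : u, join u v t ≃o r)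
      = Nat.card (Σ x : Edge r, (u ≃o trunk r x) × (t ≃o branch r x)) := by
  let F : (Σ v : u, join u v t ≃o r) → (u → r) × (t → r) := fun p =>
    (fun a => p.2 (inl u p.1 t a), fun b => p.2 (inr u p.1 t b))
  let G : (Σ x : Edge r, (u ≃o trunk r x) × (t ≃o branch r x)) → (u → r) × (t → r) := fun p =>
    (fun a => (p.2.1 a : trunkSet r p.1).1, fun b => (p.2.2 b : Set.Ici p.1.1).1)
  have hF : Function.Injective F := by
    rintro ⟨v, e⟩ ⟨v', e'⟩ h
    have h1 : ∀ a, e (inl u v t a) = e' (inl u v' t a) := fun a => congrFun (congrArg Prod.fst h) a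
    have h2 : ∀ b, e (inr u v t b) = e' (inr u v' t b) := fun a => congrFun (congrArg Prod.snd h) a
    -- The maps determine `v`: its image is the parent of the image of the root of `t`.
    have h3 : v = v' := by
      have k : ∀ (w : u) (f : join u w t ≃o r),
          f (inl u w t w) = Order.pred (f (inr u w t ⊥)) := fun w f => by
        rw [← f.map_pred]
        exact congrArg f Join.pred_right_bot.symm
      have h4 := k v e
      rw [h2, ← k v' e', h1] at h4
      have := e'.injective h4
      injection this
    subst h3
    congr 1
    ext a
    rcases a with a | b
    · exact h1 a
    · exact h2 b
  have hG : Function.Injective G := by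
    rintro ⟨x, f, g⟩ ⟨x', f', g'⟩ h
    have h1 : ∀ a, (f a : trunkSet r x).1 = (f' a : trunkSet r x').1 := fun a =>
      congrFun (congrArg Prod.fst h) a
    have h2 : ∀ a, (g a : Set.Ici x.1).1 = (g' a : Set.Ici x'.1).1 := fun a =>
      congrFun (congrArg Prod.snd h) a
    -- The maps determine the cut: `x` is the image of the root of `t`.
    have h3 : x = x' := by
      have h4 := h2 ⊥
      rw [g.map_bot, g'.map_bot] at h4
      exact Subtype.ext h4
    subst h3
    congr 2
    · ext a; exact Subtype.ext (h1 a)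
    · ext a; exact Subtype.ext (h2 a)
  have hFG : Set.range F = Set.range G := by
    refine Set.Subset.antisymm ?_ ?_
    · rintro _ ⟨⟨v, e⟩, rfl⟩
      have hx : e (inr u v t ⊥) ≠ ⊥ := fun h => right_ne_bot (e.injective (h.trans e.map_bot.symm))
      exact ⟨⟨⟨_, hx⟩, joinIsoLeft e, joinIsoRight e⟩, rfl⟩
    · rintro _ ⟨⟨x, f, g⟩, rfl⟩
      exact ⟨⟨_, glue x.2 f g⟩, rfl⟩
  rw [Nat.card_congr (Equiv.ofInjective F hF), hFG, ← Nat.card_congr (Equiv.ofInjective G hG)]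

/-- The relation between the two statistics. -/
theorem beta_mul_aut (r t u : Tree) : beta r t u * r.aut = alpha t r u * (t.aut * u.aut) := by
  obtain ⟨r, rfl⟩ := exists_cl r
  obtain ⟨t, rfl⟩ := exists_cl t
  obtain ⟨u, rfl⟩ := exists_cl u
  rw [← card_iso_join, ← card_iso_cut, card_iso_join_eq_card_iso_cut]

/-- Turns a question about insertions yielding `r` into one about the edges of `r`, which for
bouquets can be listed. -/
theorem beta_ne_zero_iff {r t u : Tree} : beta r t u ≠ 0 ↔ alpha t r u ≠ 0 := by
  have h := beta_mul_aut r t u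
  have h1 := aut_ne_zero r
  have h2 := mul_ne_zero (aut_ne_zero t) (aut_ne_zero u)
  rw [← mul_ne_zero_iff_right h1, h, mul_ne_zero_iff_right h2]

/-! ### Counting the children of the root -/

/-- The number of children of the root. -/
noncomputable def rootDeg (u : FinTree) : ℕ := Nat.card {x : u // IsAtom x}

theorem rootDeg_congr {s t : FinTree} (e : s ≃o t) : rootDeg s = rootDeg t :=
  Nat.card_congr (e.toEquiv.subtypeEquiv fun x => (e.isAtom_iff x).symm)

theorem isAtom_inl {u t : FinTree} {v x : u} (h : IsAtom (inl u v t x)) : IsAtom x :=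
  ⟨fun hx => h.1 (left_eq_bot.2 hx), fun y hy => left_eq_bot.1 (h.2 (inl u v t y)
    (show inl u v t y < inl u v t x from lt_iff_le_not_ge.2 (lt_iff_le_not_ge.1 hy :)))⟩

theorem isAtom_inl' {u t : FinTree} {v x : u} (h : IsAtom x) : IsAtom (inl u v t x) := by
  refine ⟨fun hx => h.1 (left_eq_bot.1 hx), fun y hy => ?_⟩
  rcases y with y | y
  · exact left_eq_bot.2 (h.2 y (lt_iff_le_not_ge.2 (lt_iff_le_not_ge.1 hy :)))
  · exact absurd hy.le Join.right_le_left

theorem isAtom_inr_bot (u t : FinTree) : IsAtom (inr u ⊥ t ⊥) := by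
  refine ⟨right_ne_bot, fun y hy => ?_⟩
  rcases y with y | y
  · exact left_eq_bot.2 (le_bot_iff.1 (Join.left_le_right.1 hy.le))
  · exact absurd (Join.right_le_right.2 bot_le : inr u ⊥ t ⊥ ≤ Join.right y) (not_le_of_gt hy)

theorem not_isAtom_inr {u t : FinTree} {v : u} (hv : v ≠ ⊥) (y : t) : ¬ IsAtom (inr u v t y) :=
  fun h => hv (left_eq_bot.1 (h.2 (inl u v t v)
    (lt_iff_le_not_ge.2 ⟨Join.left_le_right.2 le_rfl, Join.right_le_left⟩)))

/-- Together with the strict inequality for `v = ⊥`, this singles out the graft at the root as the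
only term of largest root degree in an insertion. -/
theorem rootDeg_join_le (u t : FinTree) {v : u} (hv : v ≠ ⊥) :
    rootDeg (join u v t) ≤ rootDeg u := by
  refine Nat.card_le_card_of_surjective
    (fun x : {x : u // IsAtom x} => ⟨inl u v t x.1, isAtom_inl' x.2⟩) ?_
  rintro ⟨x | y, hx⟩
  · exact ⟨⟨x, isAtom_inl hx⟩, rfl⟩
  · exact absurd hx (not_isAtom_inr hv y)

theorem lt_rootDeg_join_bot (u t : FinTree) : rootDeg u < rootDeg (join u ⊥ t) := by
  rw [rootDeg, ← Nat.add_one_le_iff, ← Finite.card_option]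
  refine Nat.card_le_card_of_injective (fun o : Option {x : u // IsAtom x} => match o with
    | none => ⟨inr u ⊥ t ⊥, isAtom_inr_bot u t⟩
    | some x => ⟨inl u ⊥ t x.1, isAtom_inl' x.2⟩) ?_
  rintro (_ | x) (_ | y) h
  · rfl
  · injection h with h; injection h
  · injection h with h; injection h
  · injection h with h
    injection h with h
    rw [Subtype.ext h]

/-- A tree with more than one vertex is obtained by joining a tree to a root. -/
theorem exists_join_bot (r : FinTree) (h : 1 < (cl r).size) :
    ∃ u t : FinTree, Nonempty (join u ⊥ t ≃o r) := by
  rw [size_cl, Finite.one_lt_card_iff_nontrivial] at h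
  obtain ⟨y, hy⟩ := exists_ne (⊥ : r)
  obtain ⟨x, hx, -⟩ := (eq_bot_or_exists_atom_le y).resolve_left hy
  refine ⟨trunk r ⟨x, hx.1⟩, branch r ⟨x, hx.1⟩, ⟨?_⟩⟩
  have e : join (trunk r ⟨x, hx.1⟩) ⟨Order.pred x, not_le_pred hx.1⟩ (branch r ⟨x, hx.1⟩) ≃o r :=
    glue hx.1 (OrderIso.refl (trunk r ⟨x, hx.1⟩)) (OrderIso.refl (branch r ⟨x, hx.1⟩))
  -- An atom is a child of the root, so the graft takes place at the root of the trunk.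
  have : (⟨Order.pred x, not_le_pred hx.1⟩ : trunk r ⟨x, hx.1⟩) = ⊥ := Subtype.ext
    (hx.2 _ (Order.pred_lt_of_not_isMin fun h => hx.1 h.eq_bot))
  rwa [this] at e

/-- A functional which vanishes on all insertions vanishes on all trees with several vertices. -/
theorem eq_zero_of_up_eq_zero (f : TreeSpace →ₗ[ℂ] ℂ)
    (h : ∀ s u : Tree, f (up s (δ u)) = 0) {r : Tree} (hr : 1 < r.size) : f (δ r) = 0 := by
  obtain ⟨r, rfl⟩ := exists_cl r
  induction hm : rootDeg r using Nat.strong_induction_on generalizing r with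
  | _ m ih =>
  obtain ⟨u, t, ⟨e⟩⟩ := exists_join_bot r hr
  have h1 := h (cl t) (cl u)
  -- Grafting away from the root gives smaller root degree than that of `r`, so `f` vanishes there
  -- by induction and only the graft at the root, which is `r`, survives.
  rw [up_δ, map_sum, Finset.sum_eq_single ⊥] at h1
  · rwa [cl_eq_cl.2 ⟨e⟩] at h1
  · intro v _ hv
    refine ih _ ?_ _ ?_ rfl
    · rw [← hm, ← rootDeg_congr e]
      exact (rootDeg_join_le u t hv).trans_lt (lt_rootDeg_join_bot u t)
    · rw [size_cl, card_join]
      have := card_pos u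
      have := card_pos t
      omega
  · simp

/-! ### Bouquets -/

/-- The tree whose root carries `k` copies of `t`. -/
noncomputable def bouquet (t : FinTree) : ℕ → FinTree
  | 0 => onePoint
  | k + 1 => join (bouquet t k) ⊥ t

theorem size_bouquet (t : FinTree) (k : ℕ) :
    (cl (bouquet t k)).size = k * (cl t).size + 1 := by
  induction k with
  | zero => rw [bouquet, size_onePoint, zero_mul]
  | succ k ih => rw [bouquet, size_cl, card_join, ← size_cl, ← size_cl, ih]; ring

theorem size_br_lt (u : FinTree) {x : u} (h : x ≠ ⊥) : (br u x).size < (cl u).size := by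
  have := size_br_add_size_tr u h
  have := size_pos (tr u x)
  omega

/-- A vertex other than the root is either the root of one of the copies of `t`, and then a whole
copy is removed, or lies properly inside a copy and has fewer than `|t|` descendants. -/
theorem bouquet_cut (t : FinTree) (k : ℕ) (x : bouquet t (k + 1)) (hx : x ≠ ⊥) :
    (br (bouquet t (k + 1)) x = cl t ∧ tr (bouquet t (k + 1)) x = cl (bouquet t k)) ∨
      (br (bouquet t (k + 1)) x).size < (cl t).size := by
  induction k with
  | zero =>
    rcases x with x | y
    · exact absurd rfl hx
    · by_cases hy : y = ⊥
      · subst hy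
        exact .inl ⟨(br_join_right _ _ _ _).trans (br_bot t), tr_join_right_bot _ _ _⟩
      · refine .inr ?_
        rw [show br (bouquet t 1) (Join.right y) = br t y from br_join_right _ _ _ _]
        exact size_br_lt t hy
  | succ k ih =>
    rcases x with x | y
    · have hx' : x ≠ ⊥ := fun h => hx (left_eq_bot.2 h)
      have hn : ¬ x ≤ ⊥ := fun h => hx' (le_bot_iff.1 h)
      rw [show br (bouquet t (k + 2)) (Join.left x) = br (bouquet t (k + 1)) x from
          br_join_left' _ _ _ _ hn,
        show tr (bouquet t (k + 2)) (Join.left x) =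
          cl (join (trunk (bouquet t (k + 1)) ⟨x, hx'⟩) (trunkMk hx' hn) t) from
          tr_join_left' _ _ _ _ hx' hn]
      -- If a whole copy is cut off, the trunk is the bouquet with one copy less, and the copy
      -- attached last still hangs at its root.
      refine (ih x hx').imp_left fun h => ⟨h.1, ?_⟩
      rw [← cl_trunk _ ⟨x, hx'⟩] at h
      obtain ⟨e⟩ := cl_eq_cl.1 h.2
      rw [cl_eq_cl.2 ⟨joinCongr e (OrderIso.refl t) _⟩]
      congr 2
      exact e.map_bot
    · by_cases hy : y = ⊥
      · subst hy
        exact .inl ⟨(br_join_right _ _ _ _).trans (br_bot t), tr_join_right_bot _ _ _⟩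
      · refine .inr ?_
        rw [show br (bouquet t (k + 2)) (Join.right y) = br t y from br_join_right _ _ _ _]
        exact size_br_lt t hy

theorem beta_bouquet {t : FinTree} {k : ℕ} {s u : Tree} (hs : s.size = (cl t).size)
    (h : beta (cl (bouquet t (k + 1))) s u ≠ 0) : s = cl t ∧ u = cl (bouquet t k) := by
  rw [beta_ne_zero_iff, alpha_cl] at h
  obtain ⟨⟨x, h1, hx, h2⟩⟩ := (Nat.card_ne_zero.1 h).1
  rcases bouquet_cut t k x hx with h3 | h3
  · exact ⟨h2 ▸ h3.1, h1 ▸ h3.2⟩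
  · rw [h2] at h3
    omega

theorem beta_bouquet_ne_zero (t : FinTree) (k : ℕ) :
    beta (cl (bouquet t (k + 1))) (cl t) (cl (bouquet t k)) ≠ 0 := by
  rw [beta_cl]
  exact Nat.card_ne_zero.2 ⟨⟨⟨⊥, rfl⟩⟩, inferInstance⟩

/-- A cut detaches at most `|t|` vertices, so with two or more copies more than `|t|` remain. For a
single copy this can fail, whence the `k + 2`. -/
theorem beta_bouquet_eq_zero {t : FinTree} {k : ℕ} {s u : Tree} (hu : u.size = (cl t).size) :
    beta (cl (bouquet t (k + 2))) s u = 0 := by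
  by_contra h
  have hsz := beta_ne_zero h
  rw [← ne_eq, beta_ne_zero_iff, alpha_cl] at h
  obtain ⟨⟨x, h1, hx, h2⟩⟩ := (Nat.card_ne_zero.1 h).1
  rw [size_bouquet, hu] at hsz
  have : (k + 2) * (cl t).size = k * (cl t).size + 2 * (cl t).size := by ring
  rcases bouquet_cut t (k + 1) x hx with h3 | h3
  · rw [← h2, h3.1] at hsz
    have := Nat.zero_le (k * (cl t).size)
    omega
  · rw [h2] at h3
    omega


/-! ### The Chevalley involution -/

/-- The symmetric form on the span of trees for which distinct trees are orthogonal and the square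
of a tree is its number of automorphisms. -/
noncomputable def form : TreeSpace →ₗ[ℂ] TreeSpace →ₗ[ℂ] ℂ :=
  δ.constr ℂ fun u => (u.aut : ℂ) • δ.coord u

theorem form_δ (u : Tree) (x : TreeSpace) : form (δ u) x = u.aut * δ.coord u x := by
  rw [form, δ.constr_basis]
  rfl

theorem form_comm (x y : TreeSpace) : form x y = form y x := by
  classical
  have : form = form.flip := by
    refine δ.ext fun u => δ.ext fun r => ?_
    rw [LinearMap.flip_apply, form_δ, form_δ, coord_δ, coord_δ]
    by_cases h : r = u
    · rw [h]
    · rw [if_neg h, if_neg (Ne.symm h), mul_zero, mul_zero]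
  exact LinearMap.congr_fun₂ this x y

theorem eq_of_form_eq {x y : TreeSpace} (h : ∀ z, form z x = form z y) : x = y := by
  refine δ.ext_elem fun u => ?_
  have := h (δ u)
  rw [form_δ, form_δ] at this
  exact mul_left_cancel₀ (Nat.cast_ne_zero.2 (aut_ne_zero u)) this

/-- On basis vectors this is `beta_mul_aut`. -/
theorem form_up (t : Tree) (x y : TreeSpace) : form (up t x) y = t.aut * form x (dn t y) := by
  have : form ∘ₗ up t = (t.aut : ℂ) • form.compl₂ (dn t) := by
    refine δ.ext fun u => δ.ext fun r => ?_
    rw [LinearMap.comp_apply, LinearMap.smul_apply, LinearMap.smul_apply, LinearMap.compl₂_apply,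
      form_comm, form_δ, form_δ, up_δ_apply, dn_δ_apply, smul_eq_mul]
    have := beta_mul_aut r t u
    have : (beta r t u : ℂ) * r.aut = alpha t r u * (t.aut * u.aut) := by exact_mod_cast this
    linear_combination this
  exact LinearMap.congr_fun₂ this x y

theorem form_gr (x y : TreeSpace) : form (gr x) y = form x (gr y) := by
  classical
  have : form ∘ₗ gr = form.compl₂ gr := by
    refine δ.ext fun u => δ.ext fun r => ?_
    rw [LinearMap.comp_apply, LinearMap.compl₂_apply, gr_δ, gr_δ, map_smul, LinearMap.smul_apply,
      map_smul, form_δ, coord_δ, smul_eq_mul, smul_eq_mul]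
    split_ifs with h
    · rw [h]
    · simp
  exact LinearMap.congr_fun₂ this x y

/-- The linear map with `d ↦ -d`, `D_t^+ ↦ -|Aut t| D_t^-` and `D_t^- ↦ -|Aut t|⁻¹ D_t^+`. -/
noncomputable def omegaLin : InsElim →ₗ[ℂ] InsElim :=
  stdBasis.constr ℂ fun
    | .d => -d
    | .plus t => -((t.aut : ℂ) • Dminus t)
    | .minus t => -((t.aut : ℂ)⁻¹ • Dplus t)

theorem omegaLin_d : omegaLin d = -d := stdBasis.constr_basis ℂ _ _
theorem omegaLin_Dplus (t : Tree) : omegaLin (Dplus t) = -((t.aut : ℂ) • Dminus t) :=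
  stdBasis.constr_basis ℂ _ _
theorem omegaLin_Dminus (t : Tree) : omegaLin (Dminus t) = -((t.aut : ℂ)⁻¹ • Dplus t) :=
  stdBasis.constr_basis ℂ _ _

/-- Two linear maps agree if they agree on the standard basis. -/
theorem ext_basis {E : Type*} [AddCommGroup E] [Module ℂ E] {f g : InsElim →ₗ[ℂ] E}
    (hd : f d = g d) (hp : ∀ t, f (Dplus t) = g (Dplus t))
    (hm : ∀ t, f (Dminus t) = g (Dminus t)) : f = g := by
  refine stdBasis.ext fun i => ?_
  rcases i with _ | t | t
  · exact hd
  · exact hp t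
  · exact hm t

theorem aut_cast_ne_zero (t : Tree) : (t.aut : ℂ) ≠ 0 := Nat.cast_ne_zero.2 (aut_ne_zero t)

theorem omegaLin_omegaLin (x : InsElim) : omegaLin (omegaLin x) = x := by
  have : omegaLin ∘ₗ omegaLin = LinearMap.id := by
    refine ext_basis ?_ (fun t => ?_) (fun t => ?_) <;>
      simp [omegaLin_d, omegaLin_Dplus, omegaLin_Dminus, smul_smul,
        mul_inv_cancel₀ (aut_cast_ne_zero _), inv_mul_cancel₀ (aut_cast_ne_zero _)]
  exact LinearMap.congr_fun this x

/-- `omegaLin` corresponds to minus the adjoint with respect to `form`; its signs and factors come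
from there. -/
theorem form_rho (x : InsElim) (u v : TreeSpace) :
    form (rho x u) v = -form u (rho (omegaLin x) v) := by
  let F : InsElim →ₗ[ℂ] ℂ := (form.flip v) ∘ₗ (LinearMap.applyₗ u) ∘ₗ rho
  let G : InsElim →ₗ[ℂ] ℂ := -((form u) ∘ₗ (LinearMap.applyₗ v) ∘ₗ rho ∘ₗ omegaLin)
  have : F = G := by
    refine ext_basis ?_ (fun t => ?_) (fun t => ?_)
    · change form (rho d u) v = -form u (rho (omegaLin d) v)
      rw [omegaLin_d, map_neg, rho_d, LinearMap.neg_apply, map_neg, neg_neg, form_gr]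
    · change form (rho (Dplus t) u) v = -form u (rho (omegaLin (Dplus t)) v)
      rw [omegaLin_Dplus, map_neg, map_smul, rho_Dplus, rho_Dminus, LinearMap.neg_apply, map_neg,
        neg_neg, form_up, LinearMap.smul_apply, map_smul, smul_eq_mul]
    · change form (rho (Dminus t) u) v = -form u (rho (omegaLin (Dminus t)) v)
      rw [omegaLin_Dminus, map_neg, map_smul, rho_Dplus, rho_Dminus, LinearMap.neg_apply, map_neg,
        neg_neg, LinearMap.smul_apply, map_smul, smul_eq_mul, form_comm u, form_up, form_comm v,
        inv_mul_cancel_left₀ (aut_cast_ne_zero t)]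
  exact LinearMap.congr_fun this x

theorem rho_lie (x y : InsElim) : rho ⁅x, y⁆ = rho x * rho y - rho y * rho x := rho_bracket x y

/-- Minus the adjoint respects commutators of operators; nondegeneracy of `form` and faithfulness of
`rho` carry this back to the Lie algebra. -/
theorem omegaLin_lie (x y : InsElim) : omegaLin ⁅x, y⁆ = ⁅omegaLin x, omegaLin y⁆ := by
  refine rho_injective (LinearMap.ext fun v => eq_of_form_eq fun u => ?_)
  rw [← neg_inj, ← form_rho, rho_lie, rho_lie]
  simp only [LinearMap.sub_apply, Module.End.mul_apply, map_sub, form_rho]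
  ring

/-- The involution which exchanges `D_t^+` and `D_t^-` up to scalars. -/
noncomputable def omega : InsElim ≃ₗ⁅ℂ⁆ InsElim where
  toFun := omegaLin
  map_add' := omegaLin.map_add
  map_smul' := omegaLin.map_smul
  map_lie' {x y} := omegaLin_lie x y
  invFun := omegaLin
  left_inv := omegaLin_omegaLin
  right_inv := omegaLin_omegaLin

theorem omega_Dplus (t : Tree) : omega (Dplus t) = -((t.aut : ℂ) • Dminus t) := omegaLin_Dplus t

/-! ### Coordinates and weights -/

/-- The weight of a basis vector, its eigenvalue under the bracket with `d`. -/
noncomputable def Index.wt : Index → ℤ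
  | .d => 0
  | .plus t => t.size
  | .minus t => -t.size

/-- The coordinates with respect to the standard basis. -/
noncomputable abbrev co (i : Index) : InsElim →ₗ[ℂ] ℂ := stdBasis.coord i

theorem co_basis [DecidableEq Index] (i j : Index) :
    co i (stdBasis j) = if j = i then 1 else 0 := by
  simp [co, Finsupp.single_apply]

theorem co_basis_self (i : Index) : co i (stdBasis i) = 1 := by
  classical
  rw [co_basis, if_pos rfl]

theorem co_basis_ne {i j : Index} (h : j ≠ i) : co i (stdBasis j) = 0 := by
  classical
  rw [co_basis, if_neg h]

theorem lie_d_basis (i : Index) : ⁅d, stdBasis i⁆ = (i.wt : ℂ) • stdBasis i := by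
  change ⁅stdBasis .d, stdBasis i⁆ = _
  rw [lie_basis]
  rcases i with _ | t | t
  · simp [bb_d_d, Index.wt]
  · simp [bb_d_plus, Index.wt, Dplus]
  · simp [bb_d_minus, Index.wt, Dminus]

theorem co_ext {x y : InsElim} (h : ∀ i, co i x = co i y) : x = y := stdBasis.ext_elem h

/-- The bracket with an element, as a linear map. -/
noncomputable abbrev ad (x : InsElim) : InsElim →ₗ[ℂ] InsElim := bracket x

theorem co_lie_d (i : Index) (x : InsElim) : co i ⁅d, x⁆ = i.wt * co i x := by
  classical
  have : co i ∘ₗ ad d = (i.wt : ℂ) • co i := by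
    refine stdBasis.ext fun j => ?_
    change co i ⁅d, stdBasis j⁆ = (i.wt : ℂ) * co i (stdBasis j)
    rw [lie_d_basis, map_smul, smul_eq_mul, co_basis]
    split_ifs with h
    · rw [h]
    · simp
  exact LinearMap.congr_fun this x

theorem wt_of_co_ne_zero {m : ℤ} {x : InsElim} (h : ⁅d, x⁆ = (m : ℂ) • x) {i : Index}
    (hi : co i x ≠ 0) : i.wt = m := by
  have h1 := co_lie_d i x
  rw [h, map_smul, smul_eq_mul] at h1
  exact_mod_cast (mul_right_cancel₀ hi h1).symm

theorem co_lie_basis_eq_zero {i j k : Index} (h : k.wt ≠ i.wt + j.wt) :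
    co k ⁅stdBasis i, stdBasis j⁆ = 0 := by
  by_contra hne
  refine h (wt_of_co_ne_zero ?_ hne)
  rw [leibniz_lie, lie_d_basis, lie_d_basis, smul_lie, lie_smul, ← add_smul]
  push_cast
  rfl

theorem co_lie_eq_sum (k : Index) (x y : InsElim) :
    co k ⁅x, y⁆ = ∑ i ∈ (stdBasis.repr x).support, ∑ j ∈ (stdBasis.repr y).support,
      co i x * co j y * co k ⁅stdBasis i, stdBasis j⁆ := by
  conv_lhs => rw [← stdBasis.linearCombination_repr x, ← stdBasis.linearCombination_repr y]
  rw [Finsupp.linearCombination_apply, Finsupp.linearCombination_apply, Finsupp.sum, Finsupp.sum]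
  change co k (ad _ _) = _
  simp only [map_sum, LinearMap.sum_apply, map_smul, LinearMap.smul_apply, smul_eq_mul]
  rw [Finset.sum_comm]
  refine Finset.sum_congr rfl fun j _ => ?_
  rw [Finset.mul_sum]
  refine Finset.sum_congr rfl fun i _ => ?_
  rw [mul_comm (co i x), mul_assoc]
  rfl

theorem mem_support_repr {i : Index} {x : InsElim} :
    i ∈ (stdBasis.repr x).support ↔ co i x ≠ 0 := by
  simp [co]

theorem co_wsum {a : Tree → ℕ} (ha : (Function.support a).Finite) {k : Tree → Index}
    (hk : Function.Injective k) (r : Tree) :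
    co (k r) (∑ᶠ q, (a q : ℂ) • stdBasis (k q)) = a r := by
  classical
  rw [map_wsum ha, finsum_eq_single _ r fun q hq => by
    rw [co_basis_ne fun h => hq (hk h), smul_zero], co_basis_self, smul_eq_mul, mul_one]

theorem co_wsum_of_ne {a : Tree → ℕ} (ha : (Function.support a).Finite) {k : Tree → Index}
    {i : Index} (hk : ∀ r, k r ≠ i) : co i (∑ᶠ q, (a q : ℂ) • stdBasis (k q)) = 0 := by
  rw [map_wsum ha]
  simp only [co_basis_ne (hk _), smul_zero, finsum_zero]

theorem plus_injective : Function.Injective Index.plus := fun _ _ h => by injection h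
theorem minus_injective : Function.Injective Index.minus := fun _ _ h => by injection h

theorem co_plus_lie_plus_plus (r s t : Tree) :
    co (.plus r) ⁅Dplus s, Dplus t⁆ = (beta r s t : ℂ) - beta r t s := by
  rw [Dplus, Dplus, lie_basis, bb_plus_plus,
    wsum_sub (finite_beta_left _ _) (finite_beta_left _ _), map_sub]
  exact congrArg₂ _ (co_wsum (finite_beta_left _ _) plus_injective r)
    (co_wsum (finite_beta_left _ _) plus_injective r)

theorem co_minus_lie_minus_plus {s t : Tree} (h : s ≠ t) (u : Tree) :
    co (.minus u) ⁅Dminus s, Dplus t⁆ = (beta s t u : ℂ) := by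
  classical
  rw [Dminus, Dplus, lie_basis, bb_minus_plus, if_neg h, map_add]
  refine (congrArg₂ _ (co_wsum_of_ne (finite_alpha_right _ _) (k := .plus) fun r h => ?_)
    (co_wsum (finite_beta_right _ _) minus_injective u)).trans (zero_add _)
  injection h

/-! ### The image of `d` under an automorphism -/

/-- `x` has a component `D_t^+`, and no component of larger weight. -/
def IsTop (x : InsElim) (t : Tree) : Prop :=
  co (.plus t) x ≠ 0 ∧ ∀ i, co i x ≠ 0 → i.wt ≤ t.size

theorem exists_isTop {x : InsElim} {t : Tree} (h : co (.plus t) x ≠ 0) : ∃ t, IsTop x t := by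
  obtain ⟨i, hi, hmax⟩ := (stdBasis.repr x).support.exists_max_image Index.wt
    ⟨_, mem_support_repr.2 h⟩
  -- The largest weight is at least `|t| > 0`, so it is attained at an index of plus type.
  have h1 := hmax _ (mem_support_repr.2 h)
  have h2 := size_pos t
  rcases i with _ | s | s
  · simp only [Index.wt] at h1
    omega
  · exact ⟨s, mem_support_repr.1 hi, fun i h => hmax i (mem_support_repr.2 h)⟩
  · simp only [Index.wt] at h1
    omega

theorem Index.exists_eq_plus {i : Index} {t : Tree} (h : i.wt = t.size) :
    ∃ s : Tree, i = .plus s ∧ s.size = t.size := by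
  have := size_pos t
  rcases i with _ | s | s
  · simp only [Index.wt] at h
    omega
  · exact ⟨s, rfl, Int.ofNat_inj.1 h⟩
  · simp only [Index.wt] at h
    omega

/-- Weights add under the bracket, so both indices must attain their bounds and are of plus type.
The only cut of the larger bouquet that removes `|t|` vertices then identifies them. -/
theorem eq_of_co_lie_bouquet_ne_zero {t : FinTree} {k : ℕ} {i j : Index}
    (hi : i.wt ≤ (cl t).size) (hj : j.wt ≤ (cl (bouquet t (k + 1))).size)
    (h : co (.plus (cl (bouquet t (k + 2)))) ⁅stdBasis i, stdBasis j⁆ ≠ 0) :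
    i = .plus (cl t) ∧ j = .plus (cl (bouquet t (k + 1))) := by
  have hsz : (cl (bouquet t (k + 2))).size = (cl t).size + (cl (bouquet t (k + 1))).size := by
    rw [size_bouquet, size_bouquet]; ring
  have hw := not_imp_comm.1 co_lie_basis_eq_zero h
  change ((cl (bouquet t (k + 2))).size : ℤ) = _ at hw
  obtain ⟨s, rfl, hs⟩ := Index.exists_eq_plus (i := i) (t := cl t) (by omega)
  obtain ⟨u, rfl, -⟩ := Index.exists_eq_plus (i := j) (t := cl (bouquet t (k + 1))) (by omega)
  -- Of the two terms of the structure constant, the one for inserting `u` into `s` vanishes because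
  -- `|s| = |t|`.
  rw [show co _ ⁅stdBasis (.plus s), stdBasis (.plus u)⁆ = _ from co_plus_lie_plus_plus _ _ _,
    beta_bouquet_eq_zero hs, Nat.cast_zero, sub_zero, Nat.cast_ne_zero] at h
  obtain ⟨rfl, rfl⟩ := beta_bouquet hs h
  exact ⟨rfl, rfl⟩

/-- Among all products of components, only the one of `D_t^+` with the bouquet contributes to the
next bouquet, so nothing can cancel its coefficient. -/
theorem IsTop.lie_bouquet {x y : InsElim} {t : FinTree} {k : ℕ} (hx : IsTop x (cl t))
    (hy : IsTop y (cl (bouquet t (k + 1)))) : IsTop ⁅x, y⁆ (cl (bouquet t (k + 2))) := by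
  have hsz : (cl (bouquet t (k + 2))).size = (cl t).size + (cl (bouquet t (k + 1))).size := by
    rw [size_bouquet, size_bouquet]; ring
  have key : ∀ i ∈ (stdBasis.repr x).support, ∀ j ∈ (stdBasis.repr y).support,
      ¬ (i = .plus (cl t) ∧ j = .plus (cl (bouquet t (k + 1)))) →
      co i x * co j y * co (.plus (cl (bouquet t (k + 2)))) ⁅stdBasis i, stdBasis j⁆ = 0 := by
    intro i hi j hj hij
    rw [not_imp_comm.1 (eq_of_co_lie_bouquet_ne_zero (hx.2 i (mem_support_repr.1 hi))
      (hy.2 j (mem_support_repr.1 hj))) hij, mul_zero]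
  have hxt := mem_support_repr.2 hx.1
  constructor
  · rw [co_lie_eq_sum, Finset.sum_eq_single (.plus (cl t)),
      Finset.sum_eq_single (.plus (cl (bouquet t (k + 1))))]
    · refine mul_ne_zero (mul_ne_zero hx.1 hy.1) ?_
      rw [show co _ ⁅stdBasis (.plus (cl t)), stdBasis (.plus (cl (bouquet t (k + 1))))⁆ = _ from
        co_plus_lie_plus_plus _ _ _, beta_bouquet_eq_zero rfl, Nat.cast_zero, sub_zero]
      exact Nat.cast_ne_zero.2 (beta_bouquet_ne_zero t (k + 1))
    · exact fun j hj hne => key _ hxt j hj fun h => hne h.2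
    · exact fun h => absurd (mem_support_repr.2 hy.1) h
    · exact fun i hi hne => Finset.sum_eq_zero fun j hj => key i hi j hj fun h => hne h.1
    · exact fun h => absurd hxt h
  · intro m hm
    by_contra hlt
    refine hm ?_
    rw [co_lie_eq_sum]
    refine Finset.sum_eq_zero fun i hi => Finset.sum_eq_zero fun j hj => ?_
    rw [co_lie_basis_eq_zero, mul_zero]
    have h1 := hx.2 i (mem_support_repr.1 hi)
    have h2 := hy.2 j (mem_support_repr.1 hj)
    omega

theorem isTop_Dplus (t : Tree) : IsTop (Dplus t) t := by
  refine ⟨?_, fun i hi => ?_⟩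
  · rw [Dplus, co_basis_self]
    exact one_ne_zero
  · rw [← not_imp_comm.1 co_basis_ne hi, Index.wt]

/-- The iterated brackets of a vector with the image of `d` under an automorphism have their
coordinates in a fixed finite set. -/
theorem exists_finite_co_iterate (φ : InsElim ≃ₗ⁅ℂ⁆ InsElim) (y : InsElim) :
    ∃ T : Set Index, T.Finite ∧
      ∀ (k : ℕ) (i : Index), co i ((fun z => ⁅φ d, z⁆)^[k] y) ≠ 0 → i ∈ T := by
  -- The iterates are the images under `φ` of iterated brackets of `d` with `φ.symm y`, and the
  -- diagonal operator `ad d` never enlarges the support.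
  let S := (stdBasis.repr (φ.symm y)).support
  refine ⟨⋃ i ∈ S, ((stdBasis.repr (φ (stdBasis i))).support : Set Index),
    S.finite_toSet.biUnion fun i _ => Finset.finite_toSet _, fun k i hi => ?_⟩
  have h1 : ∃ z, (∀ j, co j z ≠ 0 → j ∈ S) ∧ (fun z => ⁅φ d, z⁆)^[k] y = φ z := by
    clear hi
    induction k with
    | zero => exact ⟨φ.symm y, fun j hj => mem_support_repr.2 hj, (φ.apply_symm_apply y).symm⟩
    | succ k ih =>
      obtain ⟨z, hz, h⟩ := ih
      refine ⟨⁅d, z⁆, fun j hj => hz j fun h0 => hj ?_, ?_⟩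
      · rw [co_lie_d, h0, mul_zero]
      · rw [Function.iterate_succ_apply', h, LieEquiv.map_lie]
  obtain ⟨z, hz, h⟩ := h1
  rw [h] at hi
  by_contra hT
  refine hi ?_
  rw [← stdBasis.linearCombination_repr z, Finsupp.linearCombination_apply, Finsupp.sum]
  change co i ((φ : InsElim →ₗ[ℂ] InsElim) _) = 0
  rw [map_sum, map_sum]
  refine Finset.sum_eq_zero fun j hj => ?_
  rw [map_smul, map_smul, smul_eq_mul]
  refine mul_eq_zero_of_right _ ?_
  by_contra hne
  exact hT (Set.mem_biUnion (hz j (mem_support_repr.1 hj)) (mem_support_repr.2 hne))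

/-- Local finiteness of `ad (φ d)` contradicts the unbounded sequence of bouquets which a leading
component `D_t^+` would generate. -/
theorem co_plus_map_d (φ : InsElim ≃ₗ⁅ℂ⁆ InsElim) (t : Tree) : co (.plus t) (φ d) = 0 := by
  by_contra h
  obtain ⟨t, ht⟩ := exists_isTop h
  obtain ⟨t, rfl⟩ := exists_cl t
  -- The sequence starts with one copy of `t` and not with the bare root: in the first bracket from
  -- the bare root, the opposite insertion could contribute.
  obtain ⟨T, hT, hco⟩ := exists_finite_co_iterate φ (Dplus (cl (bouquet t 1)))
  have htop : ∀ k, IsTop ((fun z => ⁅φ d, z⁆)^[k] (Dplus (cl (bouquet t 1))))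
      (cl (bouquet t (k + 1))) := by
    intro k
    induction k with
    | zero => exact isTop_Dplus _
    | succ k ih =>
      rw [Function.iterate_succ_apply']
      exact ht.lie_bouquet ih
  refine Set.infinite_of_injective_forall_mem (f := fun k => Index.plus (cl (bouquet t (k + 1))))
    (fun k l hkl => ?_) (fun k => hco k _ (htop k).1) hT
  have h1 := congrArg Tree.size (plus_injective hkl)
  rw [size_bouquet, size_bouquet] at h1
  have h2 := Nat.eq_of_mul_eq_mul_right (size_pos _) (Nat.add_right_cancel h1)
  omega

/-- This is `co_plus_map_d` for the composite of `φ` with `omega`. -/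
theorem co_minus_map_d (φ : InsElim ≃ₗ⁅ℂ⁆ InsElim) (t : Tree) : co (.minus t) (φ d) = 0 := by
  have h : co (.plus t) ∘ₗ omegaLin = -(t.aut : ℂ)⁻¹ • co (.minus t) := by
    classical
    refine ext_basis ?_ (fun s => ?_) (fun s => ?_)
    · rw [LinearMap.comp_apply, omegaLin_d]
      simp [d]
    · rw [LinearMap.comp_apply, omegaLin_Dplus]
      simp [Dplus, Dminus]
    · rw [LinearMap.comp_apply, omegaLin_Dminus]
      by_cases hst : s = t
      · simp [Dplus, Dminus, hst]
      · simp [Dplus, Dminus, hst]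
  have h1 : co (.plus t) (omegaLin (φ d)) = 0 := co_plus_map_d (φ.trans omega) t
  have h2 := LinearMap.congr_fun h (φ d)
  rw [LinearMap.comp_apply, h1] at h2
  simpa [aut_ne_zero] using h2.symm

theorem exists_map_d (φ : InsElim ≃ₗ⁅ℂ⁆ InsElim) : ∃ c : ℂ, φ d = c • d := by
  classical
  refine ⟨co .d (φ d), co_ext fun i => ?_⟩
  rw [map_smul]
  rcases i with _ | t | t
  · rw [d, co_basis_self, smul_eq_mul, mul_one]
  · rw [co_plus_map_d]
    simp [d]
  · rw [co_minus_map_d]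
    simp [d]

/-! ### Integrality of the weights and the sign of `φ d` -/

theorem lie_d_Dplus (t : Tree) : ⁅d, Dplus t⁆ = (t.size : ℂ) • Dplus t := lie_d_basis (.plus t)

theorem Dplus_ne_zero (t : Tree) : Dplus t ≠ 0 := stdBasis.ne_zero _

theorem exists_co_ne_zero {x : InsElim} (h : x ≠ 0) : ∃ i, co i x ≠ 0 := by
  by_contra! h0
  exact h (co_ext fun i => (h0 i).trans (map_zero _).symm)

/-- The image of a vector of weight one has eigenvalue `1` under `ad (c • d)`, while the eigenvalues
of `ad d` are integers. -/
theorem exists_int_of_map_d {φ : InsElim ≃ₗ⁅ℂ⁆ InsElim} {c : ℂ} (h : φ d = c • d) :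
    ∃ n : ℤ, c * n = 1 := by
  have h1 := congrArg φ (lie_d_Dplus (cl onePoint))
  rw [LieEquiv.map_lie, h, size_onePoint, Nat.cast_one, one_smul, smul_lie] at h1
  obtain ⟨i, hi⟩ := exists_co_ne_zero (x := φ (Dplus (cl onePoint)))
    (fun h0 => Dplus_ne_zero (cl onePoint) (φ.injective (h0.trans (map_zero φ).symm)))
  refine ⟨i.wt, mul_right_cancel₀ hi ?_⟩
  rw [one_mul, mul_assoc, ← co_lie_d, ← smul_eq_mul, ← map_smul, h1]

/-- An automorphism fixes `d` up to sign. -/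
theorem map_d_eq_or_neg (φ : InsElim ≃ₗ⁅ℂ⁆ InsElim) : φ d = d ∨ φ d = -d := by
  obtain ⟨c, hc⟩ := exists_map_d φ
  obtain ⟨c', hc'⟩ := exists_map_d φ.symm
  obtain ⟨n, hn⟩ := exists_int_of_map_d hc
  obtain ⟨m, hm⟩ := exists_int_of_map_d hc'
  have hd : d ≠ 0 := stdBasis.ne_zero _
  have hcc : c' * c = 1 := by
    have h1 : φ.symm (φ d) = d := φ.symm_apply_apply d
    rw [hc, show φ.symm (c • d) = c • φ.symm d from map_smul (φ.symm : InsElim →ₗ[ℂ] InsElim) c d,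
      hc', smul_smul] at h1
    have h2 : (c * c' - 1) • d = 0 := by rw [sub_smul, h1, one_smul, sub_self]
    linear_combination (smul_eq_zero.1 h2).resolve_right hd
  -- The integers `n = 1/c` and `m = 1/c'` belonging to `φ` and its inverse are mutually inverse,
  -- hence both are `1` or both `-1`.
  have hmn : (m : ℂ) * n = 1 := by linear_combination c' * m * hn + hm - m * n * hcc
  have hmn' : m * n = 1 := by exact_mod_cast hmn
  have hc0 : c = m := by linear_combination m * hn - c * hmn
  rcases Int.isUnit_iff.1 (IsUnit.of_mul_eq_one _ hmn') with rfl | rfl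
  · left; rw [hc, hc0]; simp
  · right; rw [hc, hc0]; simp

/-! ### Centrality of `τ_{-1}` -/

theorem tauScalar_eq_zpow (ζ : ℂˣ) (i : Index) : tauScalar ζ i = (ζ : ℂ) ^ i.wt := by
  cases i <;> simp [tauScalar, Index.wt]

theorem co_tau (ζ : ℂˣ) (i : Index) (x : InsElim) :
    co i (tau ζ x) = (ζ : ℂ) ^ i.wt * co i x := by
  classical
  have : co i ∘ₗ tauLin ζ = ((ζ : ℂ) ^ i.wt) • co i := by
    refine stdBasis.ext fun j => ?_
    rw [LinearMap.comp_apply, LinearMap.smul_apply, tauLin_basis, map_smul, smul_eq_mul,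
      smul_eq_mul, tauScalar_eq_zpow, co_basis]
    split_ifs with h
    · rw [h]
    · simp
  exact LinearMap.congr_fun this x

theorem tau_of_lie_d (ζ : ℂˣ) {m : ℤ} {x : InsElim} (h : ⁅d, x⁆ = (m : ℂ) • x) :
    tau ζ x = (ζ : ℂ) ^ m • x := by
  refine co_ext fun i => ?_
  rw [co_tau, map_smul, smul_eq_mul]
  by_cases hi : co i x = 0
  · rw [hi, mul_zero, mul_zero]
  · rw [wt_of_co_ne_zero h hi]

theorem map_smul_lieEquiv (φ : InsElim ≃ₗ⁅ℂ⁆ InsElim) (c : ℂ) (x : InsElim) :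
    φ (c • x) = c • φ x := map_smul (φ : InsElim →ₗ[ℂ] InsElim) c x

theorem map_neg_lieEquiv (φ : InsElim ≃ₗ⁅ℂ⁆ InsElim) (x : InsElim) : φ (-x) = -φ x :=
  map_neg (φ : InsElim →ₗ[ℂ] InsElim) x

/-- Two automorphisms agree if they agree on the standard basis. -/
theorem lieEquiv_ext_basis {φ ψ : InsElim ≃ₗ⁅ℂ⁆ InsElim}
    (h : ∀ i, φ (stdBasis i) = ψ (stdBasis i)) : φ = ψ :=
  LieEquiv.ext (LinearMap.congr_fun (f := (φ : InsElim →ₗ[ℂ] InsElim))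
    (g := (ψ : InsElim →ₗ[ℂ] InsElim)) (stdBasis.ext h))

/-- As `φ d = ±d`, weight `m` is carried to weight `m` or `-m`, and `(-1)^m = (-1)^(-m)`. -/
theorem tau_neg_one_mem_center : tau (-1) ∈ Subgroup.center (InsElim ≃ₗ⁅ℂ⁆ InsElim) := by
  rw [Subgroup.mem_center_iff]
  intro φ
  refine lieEquiv_ext_basis fun i => ?_
  change φ (tau (-1) (stdBasis i)) = tau (-1) (φ (stdBasis i))
  have h1 := congrArg φ (lie_d_basis i)
  rw [LieEquiv.map_lie, map_smul_lieEquiv] at h1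
  rw [tau_of_lie_d _ (lie_d_basis i), map_smul_lieEquiv]
  rcases map_d_eq_or_neg φ with h | h
  · rw [h] at h1
    rw [tau_of_lie_d _ h1]
  · rw [h, neg_lie, neg_eq_iff_eq_neg, ← neg_smul, ← Int.cast_neg] at h1
    rw [tau_of_lie_d _ h1, zpow_neg, ← inv_zpow]
    simp

/-! ### Central automorphisms -/

theorem mem_center_apply {φ : InsElim ≃ₗ⁅ℂ⁆ InsElim}
    (h : φ ∈ Subgroup.center (InsElim ≃ₗ⁅ℂ⁆ InsElim)) (ψ : InsElim ≃ₗ⁅ℂ⁆ InsElim) (x : InsElim) :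
    φ (ψ x) = ψ (φ x) :=
  (DFunLike.congr_fun (Subgroup.mem_center_iff.1 h ψ) x).symm

/-- A central automorphism preserves weights. -/
theorem wt_of_mem_center {φ : InsElim ≃ₗ⁅ℂ⁆ InsElim}
    (h : φ ∈ Subgroup.center (InsElim ≃ₗ⁅ℂ⁆ InsElim)) {i j : Index}
    (hij : co j (φ (stdBasis i)) ≠ 0) : j.wt = i.wt := by
  -- Any `ζ` that is not a root of unity separates the weights; for `2`, injectivity of `m ↦ 2^m`
  -- can be read off over the reals.
  let ζ : ℂˣ := Units.mk0 2 two_ne_zero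
  have h1 := congrArg (co j) (mem_center_apply h (tau ζ) (stdBasis i))
  rw [tau_of_lie_d _ (lie_d_basis i), map_smul_lieEquiv, co_tau, map_smul, smul_eq_mul] at h1
  have h2 : (2 : ℂ) ^ i.wt = (2 : ℂ) ^ j.wt := mul_right_cancel₀ hij h1
  have h3 : (2 : ℝ) ^ i.wt = (2 : ℝ) ^ j.wt := by
    exact Complex.ofReal_injective (by push_cast; exact h2)
  exact (zpow_right_injective₀ two_pos (by norm_num) h3).symm

/-- Commutation with `omega` forces the same scalar on both sides, whereas `τ_ζ` has inverse ones;
this is what leaves only signs in the end. -/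
theorem map_Dplus_iff_map_Dminus {φ : InsElim ≃ₗ⁅ℂ⁆ InsElim}
    (h : φ ∈ Subgroup.center (InsElim ≃ₗ⁅ℂ⁆ InsElim)) (t : Tree) (c : ℂ) :
    φ (Dplus t) = c • Dplus t ↔ φ (Dminus t) = c • Dminus t := by
  have h1 := mem_center_apply h omega (Dplus t)
  rw [omega_Dplus, map_neg_lieEquiv, map_smul_lieEquiv] at h1
  have ha := aut_cast_ne_zero t
  constructor
  · intro h2
    rw [h2, map_smul_lieEquiv, omega_Dplus, smul_neg, neg_inj, smul_comm] at h1
    exact smul_right_injective _ ha h1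
  · intro h2
    refine omega.injective ?_
    change omega (φ (Dplus t)) = omega (c • Dplus t)
    rw [← h1, h2, map_smul_lieEquiv, omega_Dplus, smul_neg, smul_comm]

theorem eq_cl_onePoint {t : Tree} (h : t.size = 1) : t = cl onePoint := by
  obtain ⟨t, rfl⟩ := exists_cl t
  by_contra hne
  have h1 := h
  rw [size_cl, Nat.card_eq_one_iff_unique] at h1
  obtain ⟨_, _⟩ := h1
  exact hne (cl_eq_cl.2 ⟨⟨⟨fun _ => PUnit.unit, fun _ => ⊥, fun _ => Subsingleton.elim _ _,
    fun _ => rfl⟩, fun {a b} => ⟨fun _ => (Subsingleton.elim a b).le, fun _ => le_rfl⟩⟩⟩)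

theorem eq_plus_onePoint {i : Index} (h : i.wt = 1) : i = .plus (cl onePoint) := by
  have h1 := size_onePoint
  obtain ⟨s, rfl, hs⟩ := Index.exists_eq_plus (i := i) (t := cl onePoint) (by omega)
  rw [eq_cl_onePoint (hs.trans h1)]

/-- Weights are preserved, and the space of weight one is a line since only one tree has a single
vertex. -/
theorem exists_map_Dplus_onePoint {φ : InsElim ≃ₗ⁅ℂ⁆ InsElim}
    (h : φ ∈ Subgroup.center (InsElim ≃ₗ⁅ℂ⁆ InsElim)) :
    ∃ c : ℂ, φ (Dplus (cl onePoint)) = c • Dplus (cl onePoint) := by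
  refine ⟨co (.plus (cl onePoint)) (φ (Dplus (cl onePoint))), co_ext fun i => ?_⟩
  rw [map_smul, Dplus, smul_eq_mul]
  by_cases hi : .plus (cl onePoint) = i
  · subst hi
    rw [co_basis_self, mul_one]
  · rw [co_basis_ne hi, mul_zero]
    by_contra hne
    have h1 := wt_of_mem_center h hne
    refine hi (eq_plus_onePoint (h1.trans ?_)).symm
    rw [Index.wt, size_onePoint, Nat.cast_one]

theorem lie_Dminus_Dplus (t : Tree) : ⁅Dminus t, Dplus t⁆ = d := by
  classical
  rw [Dminus, Dplus, lie_basis, bb_minus_plus, if_pos rfl]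

/-- The bracket of the two one-vertex vectors gives `φ d = c² d`; applying `φ` to `[d, D^+] = D^+`
then yields `c³ = c`. -/
theorem eq_one_or_neg_one_of_map_onePoint {φ : InsElim ≃ₗ⁅ℂ⁆ InsElim}
    (h : φ ∈ Subgroup.center (InsElim ≃ₗ⁅ℂ⁆ InsElim)) {c : ℂ}
    (hc : φ (Dplus (cl onePoint)) = c • Dplus (cl onePoint)) : c = 1 ∨ c = -1 := by
  have hc' := (map_Dplus_iff_map_Dminus h _ _).1 hc
  have h1 := congrArg φ (lie_Dminus_Dplus (cl onePoint))
  rw [LieEquiv.map_lie, hc, hc', smul_lie, lie_smul, lie_Dminus_Dplus, smul_smul] at h1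
  have h2 := congrArg φ (lie_d_Dplus (cl onePoint))
  rw [LieEquiv.map_lie, ← h1, size_onePoint, Nat.cast_one, one_smul, hc, smul_lie, lie_smul,
    lie_d_Dplus, size_onePoint, Nat.cast_one, one_smul, smul_smul] at h2
  have hc0 : c ≠ 0 := by
    rintro rfl
    rw [zero_smul] at hc
    exact Dplus_ne_zero _ (φ.injective (hc.trans (map_zero φ).symm))
  have h3 := smul_left_injective ℂ (Dplus_ne_zero _) h2
  exact mul_self_eq_one_iff.1 (mul_right_cancel₀ hc0 (h3.trans (one_mul c).symm))

/-! ### Rigidity: propagation from the one-vertex tree -/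

/-- The smaller tree `s` has no branch `t`, so no `D_r^+` occurs. The remaining `r` have `|t| - |s|`
vertices, which makes an induction on size possible. -/
theorem lie_Dminus_Dplus_of_lt {s t : Tree} (h : s.size < t.size) :
    ⁅Dminus t, Dplus s⁆ = ∑ᶠ r, (beta t s r : ℂ) • Dminus r := by
  classical
  have h1 : ∀ r, alpha t s r = 0 := fun r => by
    by_contra hne
    have := alpha_ne_zero hne
    omega
  rw [Dminus, Dplus, lie_basis, bb_minus_plus, if_neg (by rintro rfl; omega)]
  simp [h1]

theorem Index.exists_eq_minus {i : Index} {t : Tree} (h : i.wt = -t.size) :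
    ∃ s : Tree, i = .minus s ∧ s.size = t.size := by
  have := size_pos t
  rcases i with _ | s | s
  · simp only [Index.wt] at h
    omega
  · simp only [Index.wt] at h
    omega
  · exact ⟨s, rfl, Int.ofNat_inj.1 (neg_inj.1 h)⟩

/-- A vector which is spanned by the `D_r^-` with `|r| = n > 1` and commutes with the `D_s^+` with
`|s| < n` vanishes. -/
theorem eq_zero_of_lie_Dplus_eq_zero {y : InsElim} {t : Tree} (ht : 1 < t.size)
    (hy : ∀ i, co i y ≠ 0 → i.wt = -t.size)
    (h : ∀ s : Tree, s.size < t.size → ⁅y, Dplus s⁆ = 0) : y = 0 := by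
  have hy' : ∀ r : Tree, co (.minus r) y ≠ 0 → r.size = t.size := fun r hr =>
    Int.ofNat_inj.1 (neg_inj.1 (hy _ hr))
  -- With this functional, the coordinates of `⁅y, D_s^+⁆` are the values of `f` on insertions of
  -- `s`.
  let f : TreeSpace →ₗ[ℂ] ℂ := δ.constr ℂ fun r => co (.minus r) y
  have hf : ∀ r, f (δ r) = co (.minus r) y := fun r => δ.constr_basis ℂ _ r
  have hsum : y = ∑ r ∈ (finite_size t.size).toFinset, co (.minus r) y • Dminus r := by
    classical
    refine co_ext fun i => ?_
    simp only [map_sum, map_smul, smul_eq_mul, Dminus]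
    by_cases hi : co i y = 0
    · refine hi.trans (Finset.sum_eq_zero fun r _ => ?_).symm
      by_cases hri : .minus r = i
      · rw [hri, hi, zero_mul]
      · rw [co_basis_ne hri, mul_zero]
    · obtain ⟨r, rfl, hr⟩ := Index.exists_eq_minus (hy i hi)
      rw [Finset.sum_eq_single r, co_basis_self, mul_one]
      · intro q _ hq
        rw [co_basis_ne fun h => hq (minus_injective h), mul_zero]
      · exact fun h => absurd ((finite_size t.size).mem_toFinset.2 hr) h
  have hup : ∀ s u : Tree, f (up s (δ u)) = 0 := by
    intro s u
    -- For `|s| ≥ |t|` an insertion of `s` has more than `|t|` vertices, where `f` is zero; only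
    -- `|s| < |t|` needs the hypothesis `h`.
    obtain hs | hs := lt_or_ge s.size t.size
    · have h1 := congrArg (co (.minus u)) (h s hs)
      rw [hsum, map_zero] at h1
      change co (.minus u) (bracket.flip (Dplus s) _) = 0 at h1
      rw [map_sum, map_sum] at h1
      rw [up, lc_δ, map_wsum (finite_beta_left _ _), ← h1]
      simp only [hf]
      rw [finsum_eq_sum_of_support_subset (s := (finite_size t.size).toFinset)]
      · refine Finset.sum_congr rfl fun r hr => ?_
        rw [map_smul, map_smul, smul_eq_mul, smul_eq_mul, mul_comm]
        refine congrArg _ (co_minus_lie_minus_plus ?_ u).symm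
        -- Since `|r| = |t| > |s|`, the exceptional bracket `[D_s^-, D_s^+] = d` does not enter.
        rintro rfl
        rw [Set.Finite.mem_toFinset] at hr
        exact hs.ne hr
      · intro r hr
        rw [Set.Finite.coe_toFinset]
        exact hy' r (right_ne_zero_of_smul hr)
    · rw [up, lc_δ, map_wsum (finite_beta_left _ _)]
      refine (finsum_congr fun r => ?_).trans finsum_zero
      by_contra hne
      have h1 := beta_ne_zero fun h0 => hne (by rw [h0, Nat.cast_zero, zero_smul])
      have h2 := hy' r fun h0 => hne (by rw [hf, h0, smul_zero])
      have := size_pos u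
      omega
  refine co_ext fun i => ?_
  rw [map_zero]
  by_contra hi
  obtain ⟨r, rfl, hr⟩ := Index.exists_eq_minus (hy i hi)
  exact hi ((hf r).symm.trans (eq_zero_of_up_eq_zero f hup (hr ▸ ht)))

/-- Strong induction on size settles the `D_t^-`; `omega` carries each case over to `D_t^+`, and `d`
is a bracket of the two. -/
theorem eq_one_of_mem_center {φ : InsElim ≃ₗ⁅ℂ⁆ InsElim}
    (h : φ ∈ Subgroup.center (InsElim ≃ₗ⁅ℂ⁆ InsElim))
    (h1 : φ (Dplus (cl onePoint)) = Dplus (cl onePoint)) : φ = 1 := by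
  have hiff : ∀ t, φ (Dplus t) = Dplus t ↔ φ (Dminus t) = Dminus t := fun t => by
    simpa using map_Dplus_iff_map_Dminus h t 1
  have key : ∀ n, ∀ t : Tree, t.size = n → φ (Dminus t) = Dminus t := by
    intro n
    induction n using Nat.strong_induction_on with
    | _ n ih =>
    rintro t rfl
    obtain ht | ht := (Nat.succ_le_of_lt (size_pos t)).eq_or_lt
    · rw [eq_cl_onePoint ht.symm]
      exact (hiff _).1 h1
    · refine sub_eq_zero.1 (eq_zero_of_lie_Dplus_eq_zero ht (fun i hi => ?_) fun s hs => ?_)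
      · by_contra hne
        refine hi ?_
        rw [map_sub, Dminus, not_imp_comm.1 (wt_of_mem_center h (i := .minus t) (j := i)) hne,
          co_basis_ne fun h0 => hne (congrArg Index.wt h0.symm), sub_zero]
      · rw [sub_lie, sub_eq_zero]
        -- As `φ` fixes `D_s^+` by induction, the first bracket is `φ ⁅D_t^-, D_s^+⁆`, and this
        -- involves only `D_r^-` with `|r| < |t|`, which `φ` also fixes.
        nth_rewrite 1 [← (hiff s).2 (ih _ hs s rfl)]
        rw [← LieEquiv.map_lie, lie_Dminus_Dplus_of_lt hs]
        refine (map_wsum (finite_beta_right _ _) _ (φ : InsElim →ₗ[ℂ] InsElim)).trans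
          (finsum_congr fun r => ?_)
        by_cases hr : beta t s r = 0
        · rw [hr, Nat.cast_zero, zero_smul, zero_smul]
        · have := beta_ne_zero hr
          have := size_pos s
          exact congrArg _ (ih r.size (by omega) r rfl)
  refine lieEquiv_ext_basis fun i => ?_
  change φ (stdBasis i) = stdBasis i
  rcases i with _ | t | t
  · have h2 := congrArg φ (lie_Dminus_Dplus (cl onePoint))
    rw [LieEquiv.map_lie, h1, (hiff _).1 h1, lie_Dminus_Dplus] at h2
    exact h2.symm
  · exact (hiff t).2 (key _ t rfl)
  · exact key _ t rfl

/-! ### Values of `τ_{-1}` and conclusion -/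

theorem tau_neg_one_Dplus_onePoint :
    tau (-1) (Dplus (cl onePoint)) = -Dplus (cl onePoint) := by
  rw [tau_Dplus, size_onePoint]
  simp

theorem tau_neg_one_mul_self : tau (-1) * tau (-1) = 1 := by
  refine LieEquiv.ext fun x => co_ext fun i => ?_
  change co i (tau (-1) (tau (-1) x)) = co i x
  rw [co_tau, co_tau, ← mul_assoc, ← mul_zpow]
  simp

end InsertionElimination

open InsertionElimination in
/-- The center of the group of automorphisms of the insertion-elimination algebra consists of
exactly two elements, the identity and `τ_{-1}`. -/
theorem mainTheorem10 :
    (Subgroup.center (InsertionElimination.InsElim ≃ₗ⁅ℂ⁆ InsertionElimination.InsElim) :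
        Set (InsertionElimination.InsElim ≃ₗ⁅ℂ⁆ InsertionElimination.InsElim)) =
      {LieEquiv.refl, InsertionElimination.tau (-1)} ∧
    InsertionElimination.tau (-1) ≠ LieEquiv.refl := by
  refine ⟨Set.Subset.antisymm (fun φ hφ => ?_) ?_, fun h => ?_⟩
  · obtain ⟨c, hc⟩ := exists_map_Dplus_onePoint hφ
    rcases eq_one_or_neg_one_of_map_onePoint hφ hc with rfl | rfl
    · exact .inl (eq_one_of_mem_center hφ (hc.trans (one_smul _ _)))
    · refine .inr ?_
      -- For `c = -1` the product `τ_{-1} φ` is central and fixes `D^+` of the one-vertex tree, so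
      -- it is trivial, and `τ_{-1}` is its own inverse.
      have h1 := eq_one_of_mem_center (mul_mem tau_neg_one_mem_center hφ) (by
        change tau (-1) (φ _) = _
        rw [hc, neg_one_smul, map_neg_lieEquiv, tau_neg_one_Dplus_onePoint, neg_neg])
      exact mul_left_cancel (h1.trans tau_neg_one_mul_self.symm)
  · rintro φ (rfl | rfl)
    · exact one_mem (Subgroup.center (InsElim ≃ₗ⁅ℂ⁆ InsElim))
    · exact tau_neg_one_mem_center
  · have h1 := DFunLike.congr_fun h (Dplus (cl onePoint))
    rw [tau_neg_one_Dplus_onePoint] at h1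
    have h2 := congrArg (co (.plus (cl onePoint))) h1
    change co _ (-Dplus _) = co _ (Dplus _) at h2
    rw [map_neg, Dplus, co_basis_self] at h2
    norm_num at h2
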